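/- **Part 1 (core graphs).** Let $\Lambda$ be a set of colors and let $\mathbb Z[\Lambda]=\mathbb Z[X_\lambda,x_\lambda,Y_\lambda,y_\lambda:\lambda\in\Lambda]$. For a connected multigraph $G$ with edges bijectively labeled $1,\dots,m$ and colored by $\Lambda$, the colored Tutte polynomial $T(G)\in\mathbb Z[\Lambda]$ is the sum over all spanning trees $\mathcal T$ of the product of the edge weights, an edge of color $\lambda$ having weight $X_\lambda$, $x_\lambda$, $Y_\lambda$ or $y_\lambda$ according to whether it is internally active, internally inactive, externally active or externally inactive. (An edge $e\in\mathcal T$ is internally active if its label is smaller than that of every $f\ne e$ for which $(\mathcal T-e)\cup f$ is a spanning tree; an edge $f\notin\mathcal T$ is externally active if its label is smallest on the unique cycle in $\mathcal T\cup f$.) Let $P$ be a prime ideal of $\mathbb Z[\Lambda]$ that contains none of the variables $X_\lambda,x_\lambda,Y_\lambda,y_\lambda$ and contains, for all $\lambda,\mu\in\Lambda$, the polynomials $$\det\begin{bmatrix}X_\lambda&y_\lambda\\X_\mu&y_\mu\end{bmatrix}-\det\begin{bmatrix}x_\lambda&y_\lambda\\x_\mu&y_\mu\end{bmatrix},\qquad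 \det\begin{bmatrix}x_\lambda&y_\lambda\\x_\mu&y_\mu\end{bmatrix}-\det\begin{bmatrix}x_\lambda&Y_\lambda\\x_\mu&Y_\mu\end{bmatrix},$$ and let $K$ be the field of fractions of $\mathbb Z[\Lambda]/P$. The core graph $G_n$ ($n\ge0$) has a central vertex $0$, major vertices $1,\dots,\lceil n/2\rceil$, and edges $e_1,\dots,e_n$ labeled by their indices: for odd $k$, $e_k$ joins $0$ to $(k+1)/2$; for even $k<n$, $e_k$ joins $k/2$ to $k/2+1$; for even $k=n$, $e_n$ joins $n/2$ to $0$. Let $e_k$ have color $\lambda_k\in\Lambda$, write $X_k,x_k,Y_k,y_k$ for the images in $K$ of the variables of color $\lambda_k$, and let $T_n\in K$ be the image of $T(G_n)$. Then the element $u=(X_\lambda-x_\lambda)/y_\lambda\in K$ does not depend on $\lambda\in\Lambda$. Put $u_0=1$, $u_1=y_1$, and for $k\ge2$ put $u_k=X_{k-1}y_k$ if $k$ is odd and $u_k=Y_{k-1}x_k$ if $k$ is even; put $v_k=x_k$ for odd $k$ and $v_k=y_k$ for even $k\ge2$; and let $u_{2m}!!=\prod_{j=0}^m u_{2j}$, $u_{2m+1}!!=\prod_{j=0}^m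 u_{2j+1}$. Then $u_n!!\neq0$ for all $n\ge0$, and with $c_k=\dfrac{v_k\,u_{k-1}!!}{u_k!!}$ for $k\ge 1$ there is a sequence $(S_n)_{n\ge-1}$ in $K$ with $S_{-1}=u$ such that for all $n\ge0$ $$T_n=u_n!!\,S_n,\qquad \begin{bmatrix}S_n\\S_{n-1}\end{bmatrix}=\begin{bmatrix}c_n&1\\1&0\end{bmatrix}\begin{bmatrix}c_{n-1}&1\\1&0\end{bmatrix}\cdots\begin{bmatrix}c_1&1\\1&0\end{bmatrix}\begin{bmatrix}1\\u\end{bmatrix}.$$ Moreover, if $n\ge1$ and $S_k\ne0$ for $0\le k<n$, then $S_n/S_{n-1}$ is the ordinary continued fraction $c_n+\cfrac1{c_{n-1}+\cfrac1{\ddots+\cfrac1{c_1+u}}}$. **Part 2 (Kauffman bracket).** Let $R$ be a commutative ring and $A\in R$ a unit (for instance $R=\mathbb Z[A,A^{-1}]$), and put $d=-A^2-A^{-2}$. The Kauffman bracket of an unoriented link diagram is the sum over its Kauffman states of $A^{\#A-\#B}\,d^{\#\text{loops}-1}$, where $\#A$ and $\#B$ count the $A$- and $B$-smoothings; the $A$-smoothing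 of a crossing merges the two regions swept by the over-strand turning counterclockwise. Let $a_1,\dots,a_N$ be nonzero integers and $\varepsilon_k=\operatorname{sign}(a_k)$. For $0\le n\le N$ let $K_n=K([0,a_1,\dots,a_n])$ be the Kauffman bracket of the standard ($4$-plat) diagram of the unoriented rational link encoded by $[0,a_1,\dots,a_n]$: there are four horizontal strand positions, numbered from the top; on the left positions $1,2$ and $3,4$ are joined; then come twist boxes $1,\dots,n$ from left to right, the $i$-th consisting of $|a_i|$ crossings of positions $2,3$ if $i$ is odd and of positions $1,2$ if $i$ is even, the over-strand running from bottom left to top right if $(-1)^{i-1}\varepsilon_i=1$ and from top left to bottom right otherwise; on the right positions $1,2$ and $3,4$ are joined if $n$ is odd, and positions $2,3$ and $1,4$ are joined if $n$ is even. With $[m]_q=1+q+\cdots+q^{m-1}$, define $$\omega_k=(-A^{2(-1)^k})^{a_{k-1}+a_{k-3}+\cdots}\,A^{(-1)^k(a_1+\cdots+a_k)},$$ $$\gamma_k=A^{2(-1)^{k-1}\varepsilon_k}\,[\,|a_k|\,]_{-A^{4(-1)^{k-1}\varepsilon_k}}\,(-A^{4(-1)^{k-1}})^{a_1+\cdots+a_{k-1}},$$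 where the sum $a_{k-1}+a_{k-3}+\cdots$ runs over positive indices. Then there is a sequence $(\kappa_n)_{-1\le n\le N}$ in $R$ with $\kappa_{-1}=d$ such that for all $0\le n\le N$ $$K_n=\omega_n\,\kappa_n,\qquad \begin{bmatrix}\kappa_n\\\kappa_{n-1}\end{bmatrix}=\begin{bmatrix}\gamma_n&1\\1&0\end{bmatrix}\cdots\begin{bmatrix}\gamma_1&1\\1&0\end{bmatrix}\begin{bmatrix}1\\d\end{bmatrix}.$$ -/

import Mathlib

universe uL uK uR

/-! ### Generalities -/

/-- The ordered product `M n * M (n - 1) * ⋯ * M 1` (the identity matrix for `n = 0`). -/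
def descProd {R : Type*} [CommRing R] (M : ℕ → Matrix (Fin 2) (Fin 2) R) :
    ℕ → Matrix (Fin 2) (Fin 2) R
  | 0 => 1
  | n + 1 => M (n + 1) * descProd M n

/-- Generalized semifactorials:
`p_{2m}!! = p_0 p_2 ⋯ p_{2m}` and `p_{2m+1}!! = p_1 p_3 ⋯ p_{2m+1}`. -/
def semifactorial {R : Type*} [CommRing R] (p : ℕ → R) (n : ℕ) : R :=
  ∏ j ∈ Finset.range (n / 2 + 1), p (n % 2 + 2 * j)

/-- The `q`-integer `[m]_q = 1 + q + ⋯ + q^{m-1}`. -/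
def qInt {R : Type*} [CommRing R] (m : ℕ) (q : R) : R :=
  ∑ i ∈ Finset.range m, q ^ i

/-! ### Colored Tutte polynomials -/

/-- The four kinds of variables `X_l`, `x_l`, `Y_l`, `y_l` attached to a color `l`. -/
inductive VarKind : Type
  | bigX
  | smallX
  | bigY
  | smallY

/-- The polynomial ring `ℤ[X_l, x_l, Y_l, y_l : l ∈ Λ]`. -/
abbrev ColorRing (Λ : Type uL) : Type uL := MvPolynomial (VarKind × Λ) ℤ

/-- The variable of kind `s` and color `l`. -/
noncomputable def colorVar {Λ : Type uL} (s : VarKind) (l : Λ) : ColorRing Λ :=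
  MvPolynomial.X (s, l)

/-- The ideal `I₁` generated by the differences
`det [X_l, y_l; X_m, y_m] - det [x_l, y_l; x_m, y_m]` and
`det [x_l, y_l; x_m, y_m] - det [x_l, Y_l; x_m, Y_m]`. -/
noncomputable def idealI1 (Λ : Type uL) : Ideal (ColorRing Λ) :=
  Ideal.span
    ({f | ∃ l m : Λ, f =
        Matrix.det !![colorVar .bigX l, colorVar .smallY l; colorVar .bigX m, colorVar .smallY m]
        - Matrix.det !![colorVar .smallX l, colorVar .smallY l;
            colorVar .smallX m, colorVar .smallY m]} ∪
     {f | ∃ l m : Λ, f =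
        Matrix.det !![colorVar .smallX l, colorVar .smallY l;
            colorVar .smallX m, colorVar .smallY m]
        - Matrix.det !![colorVar .smallX l, colorVar .bigY l;
            colorVar .smallX m, colorVar .bigY m]})

/-- A multigraph (loops and parallel edges allowed) on the vertex set `V` with `m` edges, labeled
bijectively by the linearly ordered set `Fin m` and colored by `Λ`. -/
structure ColoredGraph (Λ : Type uL) (V : Type) (m : ℕ) where
  /-- the endpoints of an edge -/
  ends : Fin m → Sym2 V
  /-- the color of an edge -/
  color : Fin m → Λ

namespace ColoredGraph

variable {Λ : Type uL} {V : Type} {m : ℕ} (G : ColoredGraph Λ V m)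

/-- The edges in `S` connect all the vertices of `G`. -/
def Connects (S : Finset (Fin m)) : Prop :=
  (SimpleGraph.fromEdgeSet (G.ends '' (S : Set (Fin m)))).Connected

/-- `T` is (the edge set of) a spanning tree: it connects all the vertices, and each of its edges
is a bridge of it, i.e. it contains no cycle. -/
def IsSpanningTree (T : Finset (Fin m)) : Prop :=
  G.Connects T ∧ ∀ e ∈ T, ¬ G.Connects (T.erase e)

/-- An edge `e` of the spanning tree `T` is internally active if its label is smaller than that of
every edge `f ≠ e` for which `(T - e) ∪ f` is a spanning tree. -/
def InternallyActive (T : Finset (Fin m)) (e : Fin m) : Prop :=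
  ∀ f : Fin m, f ≠ e → G.IsSpanningTree (insert f (T.erase e)) → e < f

/-- The edge `e` lies on the unique cycle contained in `T ∪ f` (`T` a spanning tree, `f ∉ T`):
the edges of this cycle are exactly the edges of `T ∪ f` that are not bridges of it. -/
def OnFundamentalCycle (T : Finset (Fin m)) (f e : Fin m) : Prop :=
  e ∈ insert f T ∧ G.Connects ((insert f T).erase e)

/-- An edge `f` outside the spanning tree `T` is externally active if its label is the smallest
one on the unique cycle contained in `T ∪ f`. -/
def ExternallyActive (T : Finset (Fin m)) (f : Fin m) : Prop :=
  ∀ e : Fin m, G.OnFundamentalCycle T f e → f ≤ e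

open Classical in
/-- The weight of a spanning tree: the product of `X` / `x` over its internally active / inactive
edges and of `Y` / `y` over the externally active / inactive edges outside it. -/
noncomputable def treeWeight (T : Finset (Fin m)) : ColorRing Λ :=
  (∏ e ∈ T, colorVar (if G.InternallyActive T e then .bigX else .smallX) (G.color e)) *
    ∏ f ∈ Tᶜ, colorVar (if G.ExternallyActive T f then .bigY else .smallY) (G.color f)

open Classical in
/-- The colored Tutte polynomial: the sum of the weights of all spanning trees. -/
noncomputable def tutte : ColorRing Λ :=
  ∑ T : Finset (Fin m) with G.IsSpanningTree T, G.treeWeight T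

end ColoredGraph

/-- The core graph `G_n`. The vertex `0` is the central vertex and `1, …, ⌈n/2⌉` are the major
vertices. The `k`-th edge (`1 ≤ k ≤ n`, stored at index `k - 1`) has color `c k`; for `k` odd it
joins the central vertex to the major vertex `(k+1)/2`; for `k` even it joins the major vertex
`k/2` to the next major vertex, or, when `k = n` is the last edge, to the central vertex. -/
def coreGraph {Λ : Type uL} (c : ℕ → Λ) (n : ℕ) : ColoredGraph Λ (Fin ((n + 1) / 2 + 1)) n where
  ends i :=
    if (i.val + 1) % 2 = 1 then s(0, ⟨(i.val + 2) / 2, by omega⟩)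
    else if h : i.val + 1 < n then
      s(⟨(i.val + 1) / 2, by omega⟩, ⟨(i.val + 1) / 2 + 1, by omega⟩)
    else s(⟨(i.val + 1) / 2, by omega⟩, 0)
  color i := c (i.val + 1)

section Coefficients

variable {K : Type uK} [Field K] (X x Y y : ℕ → K)

/-- `u_0 = 1`, `u_1 = y_1`, and for `k ≥ 2`: `u_k = X_{k-1} y_k` for `k` odd and
`u_k = Y_{k-1} x_k` for `k` even. -/
def coreU : ℕ → K
  | 0 => 1
  | 1 => y 1
  | k + 2 => if Odd k then X (k + 1) * y (k + 2) else Y (k + 1) * x (k + 2)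

/-- `v_k = x_k` for `k` odd and `v_k = y_k` for `k` even. -/
def coreV (k : ℕ) : K := if Odd k then x k else y k

/-- `c_k = v_k u_{k-1}!! / u_k!!` (used for `k ≥ 1`). -/
def coreC (k : ℕ) : K :=
  coreV x y k * semifactorial (coreU X x Y y) (k - 1) / semifactorial (coreU X x Y y) k

/-- The finite continued fraction `c_n + 1/(c_{n-1} + 1/(⋯ + 1/(c_1 + u)))` (used for `n ≥ 1`);
at `n = 1` it is `c_1 + u`. -/
def contFrac (c : ℕ → K) (u : K) : ℕ → K
  | 0 => u⁻¹
  | 1 => c 1 + u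
  | n + 2 => c (n + 2) + 1 / contFrac c u (n + 1)

end Coefficients

/-! ### 4-plat diagrams and the Kauffman bracket -/

/-- A crossing of a diagram drawn on four horizontal strand positions `0, 1, 2, 3`, numbered from
top to bottom. The crossing involves the positions `level` and `level + 1`; `rising` says that the
over-strand runs from bottom left to top right (otherwise it runs from top left to bottom right).
-/
structure PlatCrossing where
  level : Fin 3
  rising : Bool

/-- A 4-plat diagram: crossings from left to right, closed on the left by arcs joining the
positions `0, 1` and `2, 3`. On the right, the positions `0, 1` and `2, 3` are joined
(`nested = false`), or the positions `1, 2` and `0, 3` are joined (`nested = true`). -/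
structure PlatDiagram where
  word : List PlatCrossing
  nested : Bool

namespace PlatDiagram

variable (D : PlatDiagram)

/-- A Kauffman state: each crossing is smoothed, by its `A`-smoothing (`true`) or its
`B`-smoothing (`false`). -/
abbrev State : Type := Fin D.word.length → Bool

/-- Whether the smoothing of the crossing `t` in the state `s` is the one that looks like `)(`,
i.e. that merges the regions above and below the crossing; the other one merges the regions to the
left and to the right. The `A`-smoothing merges the two regions swept by the over-strand when it
turns counterclockwise: these are the ones above and below exactly when the over-strand is rising.
-/
def IsVertical (s : D.State) (t : Fin D.word.length) : Prop :=
  s t = (D.word.get t).rising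

/-- The elementary arcs of the smoothed diagram. The point `(t, j)` lies at strand position `j`,
just left of crossing number `t` (and right of crossing number `t - 1`). -/
def Arc (s : D.State) (p q : Fin (D.word.length + 1) × Fin 4) : Prop :=
  (p.1 = 0 ∧ q.1 = 0 ∧ ((p.2 = 0 ∧ q.2 = 1) ∨ (p.2 = 2 ∧ q.2 = 3))) ∨
  (p.1 = Fin.last _ ∧ q.1 = Fin.last _ ∧
    if D.nested then (p.2 = 1 ∧ q.2 = 2) ∨ (p.2 = 0 ∧ q.2 = 3)
    else (p.2 = 0 ∧ q.2 = 1) ∨ (p.2 = 2 ∧ q.2 = 3)) ∨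
  ∃ t : Fin D.word.length,
    (p.1 = t.castSucc ∧ q.1 = t.succ ∧ p.2 = q.2 ∧
      (D.IsVertical s t →
        p.2 ≠ (D.word.get t).level.castSucc ∧ p.2 ≠ (D.word.get t).level.succ)) ∨
    (D.IsVertical s t ∧ p.1 = q.1 ∧ (p.1 = t.castSucc ∨ p.1 = t.succ) ∧
      p.2 = (D.word.get t).level.castSucc ∧ q.2 = (D.word.get t).level.succ)

/-- The number of closed loops of the smoothed diagram. -/
noncomputable def loops (s : D.State) : ℕ :=
  Nat.card (SimpleGraph.fromRel (D.Arc s)).ConnectedComponent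

/-- The loop value `d = -A² - A⁻²`. -/
def loopValue {R : Type uR} [CommRing R] (A : Rˣ) : R :=
  -((A ^ (2 : ℤ) : Rˣ) : R) - ((A ^ (-2 : ℤ) : Rˣ) : R)

/-- The Kauffman bracket, normalized to be `1` on the crossingless circle:
the sum of `A ^ (#A-smoothings - #B-smoothings) * d ^ (#loops - 1)` over all states. -/
noncomputable def kauffmanBracket {R : Type uR} [CommRing R] (A : Rˣ) : R :=
  ∑ s : D.State,
    ((A ^ (∑ t, if s t then (1 : ℤ) else -1) : Rˣ) : R) * loopValue A ^ (D.loops s - 1)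

end PlatDiagram

/-- The crossings in the `i`-th twist box: they involve the two middle strand positions for `i` odd
and the two upper ones for `i` even. Their twist sign is `(-1)^(i-1) sign (a_i)`, and twist sign
`+` means that the over-strand is rising. -/
def boxCrossing (i : ℕ) (ai : ℤ) : PlatCrossing where
  level := if Odd i then 1 else 0
  rising := decide (0 < (-1) ^ (i + 1) * ai.sign)

/-- The standard diagram of the unoriented rational link encoded by `[0, a_1, …, a_n]`: the `i`-th
twist box consists of `|a_i|` crossings, and the closing on the right depends on the parity of `n`.
-/
def rationalDiagram (a : ℕ → ℤ) (n : ℕ) : PlatDiagram where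
  word := (List.range n).flatMap
    fun i => List.replicate (a (i + 1)).natAbs (boxCrossing (i + 1) (a (i + 1)))
  nested := decide (Even n)

section Bracket

variable {R : Type uR} [CommRing R] (A : Rˣ) (a : ℕ → ℤ)

/-- `ω_k = (-A^{2(-1)^k})^{a_{k-1} + a_{k-3} + ⋯} A^{(-1)^k (a_1 + ⋯ + a_k)}`, where the first
exponent runs over positive indices only. -/
def omegaCoeff (k : ℕ) : R :=
  (((-(A ^ (2 * (-1) ^ k : ℤ))) ^ (∑ i ∈ Finset.Ico 1 k with Odd (k + i), a i) *
    A ^ ((-1) ^ k * ∑ i ∈ Finset.Icc 1 k, a i) : Rˣ) : R)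

/-- `γ_k = A^{2(-1)^{k-1} ε_k} [|a_k|]_q (-A^{4(-1)^{k-1}})^{a_1 + ⋯ + a_{k-1}}` with
`q = -A^{4(-1)^{k-1} ε_k}` and `ε_k = sign (a_k)` (used for `k ≥ 1`; `(-1)^{k-1}` is written
`(-1)^{k+1}`). -/
def gammaCoeff (k : ℕ) : R :=
  ((A ^ (2 * (-1) ^ (k + 1) * (a k).sign) : Rˣ) : R) *
    qInt (a k).natAbs ((-(A ^ (4 * (-1) ^ (k + 1) * (a k).sign)) : Rˣ) : R) *
    (((-(A ^ (4 * (-1) ^ (k + 1) : ℤ))) ^ (∑ i ∈ Finset.Ico 1 k, a i) : Rˣ) : R)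

end Bracket

/-! Both halves rest on one mechanism. The invariants satisfy a recursion `F_n = α_n F_{n-1} + β_n
F_{n-2}` with `β_n` invertible. Writing `F_n = ω_n S_n` with `ω_n = β_n ω_{n-2}` turns the second
coefficient into 1, so `S_n = c_n S_{n-1} + S_{n-2}` with `c_n = α_n ω_{n-1} / ω_n`: a continuant,
whence the matrix product and the continued fraction. The value `S_{-1}` is the one that makes `n =
1` correct.

Core graphs: the last edge has the largest label, so its removal changes no other activity, and it
is itself active only if it is a bridge or a loop. For even `n ≥ 2`, deleting `e_n` gives `G_{n-1}`;
contracting it makes `e_{n-1}` a loop, whose removal gives `G_{n-2}`. For odd `n ≥ 3`, contracting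
gives `G_{n-1}`; deleting makes `e_{n-1}` a bridge, whose contraction gives `G_{n-2}`. Hence `T_n =
v_n T_{n-1} + u_n T_{n-2}` (`coreTutte_even`, `coreTutte_odd`). From `T_1 = X_1 = y_1 (x_1 / y_1 +
u)` one reads off `u`, and the first family of relations in `P` makes it independent of the color.

Kauffman bracket: smoothing the last crossing relates the two ways of closing a 4-plat on the right
(`platBracket_append_singleton`). If a closing arc joins the two strands of a twist box, the box is
a chain of kinks and contributes a unit; with the other closing, a geometric sum produces a
`q`-integer. The standard closing is open for box `n`. Switching it gives, after removal of box `n`,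
either `K_{n-1}` or a diagram in which box `n-1` consists of kinks, hence a multiple of `K_{n-2}`.
The rest is a comparison of exponents with `ω` and `γ`. Here `S_{-1} = d` is the bracket of two
disjoint circles. -/

/-! ### Smoothed diagrams and their loops -/

/-- The connected components of the graph generated by `r` are the classes of the equivalence
relation generated by `r`. -/
lemma card_connectedComponent_fromRel {V : Type*} (r : V → V → Prop) :
    Nat.card (SimpleGraph.fromRel r).ConnectedComponent = Nat.card (Quot r) := by
  have key : ∀ v w, (SimpleGraph.fromRel r).Reachable v w → Quot.mk r v = Quot.mk r w := by
    rintro v w ⟨p⟩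
    induction p with
    | nil => rfl
    | cons h _ ih =>
      rw [← ih]
      rw [SimpleGraph.fromRel_adj] at h
      rcases h.2 with h | h
      · exact Quot.sound h
      · exact (Quot.sound h).symm
  refine Nat.card_congr
    { toFun := SimpleGraph.ConnectedComponent.lift (Quot.mk r) fun v w p _ => key v w ⟨p⟩
      invFun := Quot.lift (SimpleGraph.fromRel r).connectedComponentMk fun v w h => ?_
      left_inv := ?_
      right_inv := ?_ }
  · rw [SimpleGraph.ConnectedComponent.eq]
    by_cases hvw : v = w
    · rw [hvw]
    · exact SimpleGraph.Adj.reachable ((SimpleGraph.fromRel_adj _ _ _).2 ⟨hvw, Or.inl h⟩)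
  · intro x
    induction x using SimpleGraph.ConnectedComponent.ind
    rfl
  · rintro ⟨x⟩
    rfl

/-- The arcs of a smoothed diagram of `n` crossings, given by their levels and their smoothings,
with the exception of the arcs that close it on the right. -/
def openArc (n : ℕ) (lev : Fin n → Fin 3) (vert : Fin n → Prop) (p q : Fin (n + 1) × Fin 4) :
    Prop :=
  (p.1 = 0 ∧ q.1 = 0 ∧ ((p.2 = 0 ∧ q.2 = 1) ∨ (p.2 = 2 ∧ q.2 = 3))) ∨
  ∃ t : Fin n,
    (p.1 = t.castSucc ∧ q.1 = t.succ ∧ p.2 = q.2 ∧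
      (vert t → p.2 ≠ (lev t).castSucc ∧ p.2 ≠ (lev t).succ)) ∨
    (vert t ∧ p.1 = q.1 ∧ (p.1 = t.castSucc ∨ p.1 = t.succ) ∧
      p.2 = (lev t).castSucc ∧ q.2 = (lev t).succ)

/-- The positions joined by the closing arcs on the right. -/
def capArc (c : Bool) (j k : Fin 4) : Prop :=
  if c then (j = 1 ∧ k = 2) ∨ (j = 0 ∧ k = 3) else (j = 0 ∧ k = 1) ∨ (j = 2 ∧ k = 3)

instance (c : Bool) (j k : Fin 4) : Decidable (capArc c j k) := by
  unfold capArc; infer_instance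

/-- All the arcs of a smoothed diagram. -/
def closedArc (n : ℕ) (lev : Fin n → Fin 3) (vert : Fin n → Prop) (c : Bool)
    (p q : Fin (n + 1) × Fin 4) : Prop :=
  openArc n lev vert p q ∨ (p.1 = Fin.last n ∧ q.1 = Fin.last n ∧ capArc c p.2 q.2)

/-- The number of loops of a smoothed diagram. -/
noncomputable def loopCount (n : ℕ) (lev : Fin n → Fin 3) (vert : Fin n → Prop) (c : Bool) : ℕ :=
  Nat.card (Quot (closedArc n lev vert c))

/-- Loops become classes of a `Quot`, so that a bijection between loop sets can be defined on points
and checked arc by arc. -/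
lemma PlatDiagram.loops_eq_loopCount (D : PlatDiagram) (s : D.State) :
    D.loops s =
      loopCount D.word.length (fun t => (D.word.get t).level) (D.IsVertical s) D.nested := by
  rw [PlatDiagram.loops, card_connectedComponent_fromRel, loopCount]
  congr 2
  funext p q
  simp only [PlatDiagram.Arc, closedArc, openArc, capArc, eq_iff_iff]
  rw [or_assoc, or_comm (a := ∃ _, _)]

/-- Needed because the exponent `loops - 1` is a truncated subtraction. -/
lemma loopCount_pos (n : ℕ) (lev : Fin n → Fin 3) (vert : Fin n → Prop) (c : Bool) :
    0 < loopCount n lev vert c := by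
  have : Nonempty (Quot (closedArc n lev vert c)) := ⟨Quot.mk _ (0, 0)⟩
  exact Nat.card_pos

/-! ### Removing the last crossing of a smoothed diagram -/

section LastCrossing

variable {n : ℕ} {lev : Fin (n + 1) → Fin 3} {vert : Fin (n + 1) → Prop}

lemma openArc_castSucc {p q : Fin (n + 1) × Fin 4}
    (h : openArc n (fun t => lev t.castSucc) (fun t => vert t.castSucc) p q) :
    openArc (n + 1) lev vert (p.1.castSucc, p.2) (q.1.castSucc, q.2) := by
  rcases h with ⟨h1, h2, h3⟩ | ⟨t, ⟨h1, h2, h3, h4⟩ | ⟨h1, h2, h3, h4⟩⟩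
  · exact Or.inl ⟨by simp [h1], by simp [h2], h3⟩
  · exact Or.inr ⟨t.castSucc, Or.inl ⟨by simp [h1], by simp [h2], h3, h4⟩⟩
  · refine Or.inr ⟨t.castSucc, Or.inr ⟨h1, by simp [h2], ?_, h4⟩⟩
    rcases h3 with h3 | h3
    · exact Or.inl (by simp [h3])
    · exact Or.inr (by simp [h3])

lemma openArc_succ_cases {p q : Fin (n + 2) × Fin 4} (h : openArc (n + 1) lev vert p q) :
    (∃ p' q' : Fin (n + 1) × Fin 4, p = (p'.1.castSucc, p'.2) ∧ q = (q'.1.castSucc, q'.2) ∧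
      openArc n (fun t => lev t.castSucc) (fun t => vert t.castSucc) p' q') ∨
    (∃ k, p = ((Fin.last n).castSucc, k) ∧ q = (Fin.last (n + 1), k) ∧
      (vert (Fin.last n) →
        k ≠ (lev (Fin.last n)).castSucc ∧ k ≠ (lev (Fin.last n)).succ)) ∨
    (vert (Fin.last n) ∧
      ((p = ((Fin.last n).castSucc, (lev (Fin.last n)).castSucc) ∧
        q = ((Fin.last n).castSucc, (lev (Fin.last n)).succ)) ∨
       (p = (Fin.last (n + 1), (lev (Fin.last n)).castSucc) ∧
        q = (Fin.last (n + 1), (lev (Fin.last n)).succ)))) := by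
  obtain ⟨p1, p2⟩ := p
  obtain ⟨q1, q2⟩ := q
  rcases h with ⟨h1, h2, h3⟩ | ⟨t, h⟩
  · simp only at h1 h2 h3
    subst h1 h2
    exact Or.inl ⟨(0, p2), (0, q2), rfl, rfl, Or.inl ⟨rfl, rfl, h3⟩⟩
  · induction t using Fin.lastCases with
    | last =>
      rcases h with ⟨h1, h2, h3, h4⟩ | ⟨h1, h2, h3, h4, h5⟩
      · simp only at h1 h2 h3 h4
        subst h1 h2 h3
        exact Or.inr (Or.inl ⟨p2, rfl, rfl, h4⟩)
      · simp only at h1 h2 h3 h4 h5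
        subst h2 h4 h5
        rcases h3 with rfl | rfl
        · exact Or.inr (Or.inr ⟨h1, Or.inl ⟨rfl, rfl⟩⟩)
        · exact Or.inr (Or.inr ⟨h1, Or.inr ⟨rfl, rfl⟩⟩)
    | cast t =>
      left
      rcases h with ⟨h1, h2, h3, h4⟩ | ⟨h1, h2, h3, h4, h5⟩
      · simp only at h1 h2 h3 h4
        subst h1 h2 h3
        exact ⟨(t.castSucc, p2), (t.succ, p2), rfl, rfl,
          Or.inr ⟨t, Or.inl ⟨rfl, rfl, rfl, h4⟩⟩⟩
      · simp only at h1 h2 h3 h4 h5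
        subst h2 h4 h5
        rcases h3 with rfl | rfl
        · exact ⟨(t.castSucc, _), (t.castSucc, _), rfl, rfl,
            Or.inr ⟨t, Or.inr ⟨h1, rfl, Or.inl rfl, rfl, rfl⟩⟩⟩
        · exact ⟨(t.succ, _), (t.succ, _), rfl, rfl,
            Or.inr ⟨t, Or.inr ⟨h1, rfl, Or.inr rfl, rfl, rfl⟩⟩⟩

lemma quot_straight (c : Bool) (k : Fin 4)
    (h : vert (Fin.last n) → k ≠ (lev (Fin.last n)).castSucc ∧ k ≠ (lev (Fin.last n)).succ) :
    Quot.mk (closedArc (n + 1) lev vert c) ((Fin.last n).castSucc, k) =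
      Quot.mk _ (Fin.last (n + 1), k) :=
  Quot.sound (Or.inl (Or.inr ⟨Fin.last n, Or.inl ⟨rfl, by simp, rfl, h⟩⟩))

lemma quot_vertical_left (c : Bool) (h : vert (Fin.last n)) :
    Quot.mk (closedArc (n + 1) lev vert c)
        ((Fin.last n).castSucc, (lev (Fin.last n)).castSucc) =
      Quot.mk _ ((Fin.last n).castSucc, (lev (Fin.last n)).succ) :=
  Quot.sound (Or.inl (Or.inr ⟨Fin.last n, Or.inr ⟨h, rfl, Or.inl rfl, rfl, rfl⟩⟩))

lemma quot_vertical_right (c : Bool) (h : vert (Fin.last n)) :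
    Quot.mk (closedArc (n + 1) lev vert c) (Fin.last (n + 1), (lev (Fin.last n)).castSucc) =
      Quot.mk _ (Fin.last (n + 1), (lev (Fin.last n)).succ) :=
  Quot.sound (Or.inl (Or.inr ⟨Fin.last n, Or.inr ⟨h, rfl, Or.inr (by simp), rfl, rfl⟩⟩))

lemma quot_cap {n : ℕ} {lev : Fin n → Fin 3} {vert : Fin n → Prop} {c : Bool} {j k : Fin 4}
    (h : capArc c j k) :
    Quot.mk (closedArc n lev vert c) (Fin.last n, j) = Quot.mk _ (Fin.last n, k) :=
  Quot.sound (Or.inr ⟨rfl, rfl, h⟩)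

/-- Removing the last crossing, where the loops are not changed: `ρ` tells how the positions on the
right of this crossing are connected to those on its left. -/
lemma loopCount_succ_of_retract {c c' : Bool} (ρ : Fin 4 → Fin 4)
    (hcap : ∀ j k, capArc c j k → ρ j = ρ k ∨ capArc c' (ρ j) (ρ k) ∨ capArc c' (ρ k) (ρ j))
    (hstraight : ∀ k, (vert (Fin.last n) →
      k ≠ (lev (Fin.last n)).castSucc ∧ k ≠ (lev (Fin.last n)).succ) → ρ k = k)
    (hleft : vert (Fin.last n) →
      capArc c' (lev (Fin.last n)).castSucc (lev (Fin.last n)).succ)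
    (hright : vert (Fin.last n) →
      capArc c' (ρ (lev (Fin.last n)).castSucc) (ρ (lev (Fin.last n)).succ) ∨
      capArc c' (ρ (lev (Fin.last n)).succ) (ρ (lev (Fin.last n)).castSucc))
    (hcap' : ∀ j k, capArc c' j k →
      Quot.mk (closedArc (n + 1) lev vert c) ((Fin.last n).castSucc, j) =
        Quot.mk _ ((Fin.last n).castSucc, k))
    (hρ : ∀ k, Quot.mk (closedArc (n + 1) lev vert c) ((Fin.last n).castSucc, ρ k) =
        Quot.mk _ (Fin.last (n + 1), k)) :
    loopCount (n + 1) lev vert c =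
      loopCount n (fun t => lev t.castSucc) (fun t => vert t.castSucc) c' := by
  let r' := closedArc n (fun t => lev t.castSucc) (fun t => vert t.castSucc) c'
  let f : Fin (n + 2) × Fin 4 → Quot r' := fun p =>
    Fin.lastCases (motive := fun _ => Quot r') (Quot.mk r' (Fin.last n, ρ p.2))
      (fun j => Quot.mk r' (j, p.2)) p.1
  have flast : ∀ k, f (Fin.last (n + 1), k) = Quot.mk r' (Fin.last n, ρ k) := fun k => by
    simp [f]
  have fcast : ∀ j k, f (Fin.castSucc j, k) = Quot.mk r' (j, k) := fun j k => by
    simp [f]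
  have cap2 : ∀ j k, capArc c' j k ∨ capArc c' k j →
      Quot.mk r' (Fin.last n, j) = Quot.mk r' (Fin.last n, k) := by
    rintro j k (h | h)
    · exact quot_cap h
    · exact (quot_cap h).symm
  refine Nat.card_congr
    { toFun := Quot.lift f ?_
      invFun := Quot.lift (fun p => Quot.mk _ (p.1.castSucc, p.2)) ?_
      left_inv := ?_
      right_inv := ?_ }
  · rintro p q (h | ⟨h1, h2, h3⟩)
    · rcases openArc_succ_cases h with ⟨p', q', rfl, rfl, h'⟩ | ⟨k, rfl, rfl, h'⟩ |
        ⟨hv, ⟨rfl, rfl⟩ | ⟨rfl, rfl⟩⟩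
      · rw [fcast, fcast]
        exact Quot.sound (Or.inl h')
      · rw [fcast, flast, hstraight k h']
      · rw [fcast, fcast]
        exact quot_cap (hleft hv)
      · rw [flast, flast]
        exact cap2 _ _ (hright hv)
    · obtain ⟨p1, p2⟩ := p
      obtain ⟨q1, q2⟩ := q
      simp only at h1 h2 h3
      subst h1 h2
      rw [flast, flast]
      rcases hcap _ _ h3 with h | h
      · rw [h]
      · exact cap2 _ _ h
  · rintro p q (h | ⟨h1, h2, h3⟩)
    · exact Quot.sound (Or.inl (openArc_castSucc h))
    · simp only [h1, h2]
      exact hcap' _ _ h3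
  · rintro ⟨p1, k⟩
    induction p1 using Fin.lastCases with
    | last =>
      change Quot.lift _ _ (f _) = _
      rw [flast]
      exact hρ k
    | cast j =>
      change Quot.lift _ _ (f _) = _
      rw [fcast]
  · rintro ⟨p1, k⟩
    exact fcast p1 k

/-- All four strands run straight through the smoothed crossing, so the right end is merely pushed
to the left. -/
lemma loopCount_succ_of_not_vert (c : Bool) (h : ¬ vert (Fin.last n)) :
    loopCount (n + 1) lev vert c =
      loopCount n (fun t => lev t.castSucc) (fun t => vert t.castSucc) c := by
  have hs := fun k => quot_straight (lev := lev) (vert := vert) c k (fun h' => (h h').elim)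
  refine loopCount_succ_of_retract id (fun j k h => Or.inr (Or.inl h)) (fun _ _ => rfl)
    (fun h' => (h h').elim) (fun h' => (h h').elim) (fun j k hjk => ?_) hs
  rw [hs, hs]
  exact quot_cap hjk

/-- The left half of `)(` joins the two crossing positions. The right half, joined to both closing
arcs, becomes a single arc between the other two positions. Together they form the other closing. -/
lemma loopCount_succ_of_open {c : Bool} (hv : vert (Fin.last n))
    (hc : c ≠ decide (lev (Fin.last n) = 1)) :
    loopCount (n + 1) lev vert c =
      loopCount n (fun t => lev t.castSucc) (fun t => vert t.castSucc) (!c) := by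
  have hs := fun k h => quot_straight (lev := lev) (vert := vert) c k (fun _ => h)
  have hl := quot_vertical_left (lev := lev) (vert := vert) c hv
  have hr := quot_vertical_right (lev := lev) (vert := vert) c hv
  have hp := fun j k => quot_cap (lev := lev) (vert := vert) (c := c) (j := j) (k := k)
  have main : ∀ (i : Fin 3), lev (Fin.last n) = i → c ≠ decide (i = 1) →
      loopCount (n + 1) lev vert c =
        loopCount n (fun t => lev t.castSucc) (fun t => vert t.castSucc) (!c) := by
    intro i hi hc
    rw [hi] at hs hl hr
    fin_cases i <;> cases c <;> simp at hc
    · have h2 := hs 2 (by decide)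
      have h3 := hs 3 (by decide)
      have h12 := hp 1 2 (by decide)
      have h03 := hp 0 3 (by decide)
      -- Each right-hand position is traced along its closing arc to a strand that avoids the
      -- crossing; similarly for the two other levels.
      refine loopCount_succ_of_retract ![3, 2, 2, 3] (by decide) ?_ ?_ ?_ ?_ ?_
      · rw [hi]; simp only [hv, true_imp_iff]; decide
      · rw [hi]; intro _; decide
      · rw [hi]; intro _; decide
      · intro j k hjk
        have : (j = 0 ∧ k = 1) ∨ (j = 2 ∧ k = 3) := hjk
        rcases this with ⟨rfl, rfl⟩ | ⟨rfl, rfl⟩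
        · exact hl
        · rw [h2, h3, ← h12, ← h03]; exact hr.symm
      · intro k
        fin_cases k
        · exact h3.trans h03.symm
        · exact h2.trans h12.symm
        · exact h2
        · exact h3
    · have h0 := hs 0 (by decide)
      have h3 := hs 3 (by decide)
      have h01 := hp 0 1 (by decide)
      have h23 := hp 2 3 (by decide)
      refine loopCount_succ_of_retract ![0, 0, 3, 3] (by decide) ?_ ?_ ?_ ?_ ?_
      · rw [hi]; simp only [hv, true_imp_iff]; decide
      · rw [hi]; intro _; decide
      · rw [hi]; intro _; decide
      · intro j k hjk
        have : (j = 1 ∧ k = 2) ∨ (j = 0 ∧ k = 3) := hjk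
        rcases this with ⟨rfl, rfl⟩ | ⟨rfl, rfl⟩
        · exact hl
        · rw [h0, h3, h01, ← h23]; exact hr
      · intro k
        fin_cases k
        · exact h0
        · exact h0.trans h01
        · exact h3.trans h23.symm
        · exact h3
    · have h0 := hs 0 (by decide)
      have h1 := hs 1 (by decide)
      have h12 := hp 1 2 (by decide)
      have h03 := hp 0 3 (by decide)
      refine loopCount_succ_of_retract ![0, 1, 1, 0] (by decide) ?_ ?_ ?_ ?_ ?_
      · rw [hi]; simp only [hv, true_imp_iff]; decide
      · rw [hi]; intro _; decide
      · rw [hi]; intro _; decide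
      · intro j k hjk
        have : (j = 0 ∧ k = 1) ∨ (j = 2 ∧ k = 3) := hjk
        rcases this with ⟨rfl, rfl⟩ | ⟨rfl, rfl⟩
        · rw [h0, h1, h03, h12]; exact hr.symm
        · exact hl
      · intro k
        fin_cases k
        · exact h0
        · exact h1
        · exact h1.trans h12
        · exact h0.trans h03
  exact main _ rfl hc

/-- The right half of `)(` and the closing arc at the same positions bound a separate loop, while
the left half replaces that closing arc. The separate loop is the `none` of an `Option`. -/
lemma loopCount_succ_of_closed {c : Bool} (hv : vert (Fin.last n))
    (hc : c = decide (lev (Fin.last n) = 1)) :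
    loopCount (n + 1) lev vert c =
      loopCount n (fun t => lev t.castSucc) (fun t => vert t.castSucc) c + 1 := by
  let r' := closedArc n (fun t => lev t.castSucc) (fun t => vert t.castSucc) c
  obtain ⟨i, hi⟩ : ∃ i, lev (Fin.last n) = i := ⟨_, rfl⟩
  rw [hi] at hc
  let f : Fin (n + 2) × Fin 4 → Option (Quot r') := fun p =>
    Fin.lastCases (motive := fun _ => Option (Quot r'))
      (if p.2 = i.castSucc ∨ p.2 = i.succ then none else some (Quot.mk r' (Fin.last n, p.2)))
      (fun j => some (Quot.mk r' (j, p.2))) p.1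
  have flast : ∀ k, f (Fin.last (n + 1), k) =
      if k = i.castSucc ∨ k = i.succ then none else some (Quot.mk r' (Fin.last n, k)) :=
    fun k => by simp [f]
  have fcast : ∀ j k, f (Fin.castSucc j, k) = some (Quot.mk r' (j, k)) := fun j k => by
    simp [f]
  have capi : capArc c i.castSucc i.succ := by
    rw [hc]; clear_value f; clear f flast fcast hc hi; revert i; decide
  have capne : ∀ j k, capArc c j k → ((j = i.castSucc ∨ j = i.succ) ∧ (k = i.castSucc ∨ k = i.succ))
      ∨ (¬ (j = i.castSucc ∨ j = i.succ) ∧ ¬ (k = i.castSucc ∨ k = i.succ)) := by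
    rw [hc]; clear_value f; clear f flast fcast hc hi capi; revert i; decide
  have hs := fun k h => quot_straight (lev := lev) (vert := vert) c k (fun _ => h)
  have hl := quot_vertical_left (lev := lev) (vert := vert) c hv
  have hr := quot_vertical_right (lev := lev) (vert := vert) c hv
  rw [hi] at hs hl hr
  rw [loopCount, loopCount, ← Finite.card_option]
  refine Nat.card_congr
    { toFun := Quot.lift f ?_
      invFun := fun o => o.elim (Quot.mk _ (Fin.last (n + 1), i.castSucc))
        (Quot.lift (fun p => Quot.mk _ (p.1.castSucc, p.2)) ?_)
      left_inv := ?_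
      right_inv := ?_ }
  · rintro p q (h | ⟨h1, h2, h3⟩)
    · rcases openArc_succ_cases h with ⟨p', q', rfl, rfl, h'⟩ | ⟨k, rfl, rfl, h'⟩ |
        ⟨-, ⟨rfl, rfl⟩ | ⟨rfl, rfl⟩⟩
      · rw [fcast, fcast]
        exact congrArg some (Quot.sound (Or.inl h'))
      · rw [hi] at h'
        rw [fcast, flast, if_neg (not_or.2 (h' hv))]
      · rw [fcast, fcast, hi]
        exact congrArg some (quot_cap capi)
      · rw [flast, flast, hi, if_pos (Or.inl rfl), if_pos (Or.inr rfl)]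
    · obtain ⟨p1, p2⟩ := p
      obtain ⟨q1, q2⟩ := q
      simp only at h1 h2 h3
      subst h1 h2
      rw [flast, flast]
      rcases capne _ _ h3 with ⟨ha, hb⟩ | ⟨ha, hb⟩
      · rw [if_pos ha, if_pos hb]
      · rw [if_neg ha, if_neg hb]
        exact congrArg some (quot_cap h3)
  · rintro ⟨p1, p2⟩ ⟨q1, q2⟩ (h | ⟨h1, h2, h3⟩)
    · exact Quot.sound (Or.inl (openArc_castSucc h))
    · simp only at h1 h2 h3
      subst h1 h2
      -- A closing arc either is the one facing the crossing or avoids its strands; this is a finite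
      -- check over levels and positions.
      have : ((p2 = i.castSucc ∧ q2 = i.succ)) ∨
          (¬ (p2 = i.castSucc ∨ p2 = i.succ) ∧ ¬ (q2 = i.castSucc ∨ q2 = i.succ)) := by
        revert h3
        rw [hc]
        clear_value f
        clear f flast fcast hc hi capi capne hs hl hr
        revert i p2 q2
        decide
      rcases this with ⟨rfl, rfl⟩ | ⟨ha, hb⟩
      · exact hl
      · exact ((hs _ (not_or.1 ha)).trans (quot_cap h3)).trans (hs _ (not_or.1 hb)).symm
  · rintro ⟨p1, k⟩
    induction p1 using Fin.lastCases with
    | last =>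
      change Option.elim (f _) _ _ = _
      rw [flast]
      split_ifs with h
      · rcases h with rfl | rfl
        · rfl
        · exact hr
      · exact hs k (not_or.1 h)
    | cast j =>
      change Option.elim (f _) _ _ = _
      rw [fcast]
      rfl
  · rintro (_ | ⟨p1, k⟩)
    · change f _ = _
      rw [flast, if_pos (Or.inl rfl)]
    · exact fcast p1 k

end LastCrossing

/-! ### The Kauffman bracket of 4-plats -/

section

variable {R : Type uR} [CommRing R] (A : Rˣ)

open PlatDiagram

/-- The state sum of the diagram with `n` crossings that is given by a function. -/
noncomputable def stateSum (n : ℕ) (cr : Fin n → PlatCrossing) (c : Bool) : R :=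
  ∑ s : Fin n → Bool, ((A ^ (∑ t, if s t then (1 : ℤ) else -1) : Rˣ) : R) *
    loopValue A ^ (loopCount n (fun t => (cr t).level) (fun t => s t = (cr t).rising) c - 1)

lemma kauffmanBracket_eq_stateSum (D : PlatDiagram) :
    D.kauffmanBracket A = stateSum A D.word.length D.word.get D.nested := by
  simp only [kauffmanBracket, stateSum, loops_eq_loopCount]
  rfl

lemma stateSum_cast {n m : ℕ} (h : n = m) (cr : Fin m → PlatCrossing) (c : Bool) :
    stateSum A n (fun t => cr (Fin.cast h t)) c = stateSum A m cr c := by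
  subst h
  rfl

/-- The exponent of `A` for the smoothing of a crossing that merges the regions above and below. -/
def crossSign (t : PlatCrossing) : ℤ := if t.rising then 1 else -1

/-- The skein relation: the states are grouped by the smoothing of the last crossing, and the loop
counts before and after its removal are compared. -/
lemma stateSum_succ (n : ℕ) (cr : Fin (n + 1) → PlatCrossing) (c : Bool) :
    stateSum A (n + 1) cr c =
      ((A ^ (-crossSign (cr (Fin.last n))) : Rˣ) : R) *
        stateSum A n (fun t => cr t.castSucc) c +
      ((A ^ crossSign (cr (Fin.last n)) : Rˣ) : R) *
        (if c = decide ((cr (Fin.last n)).level = 1) then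
          loopValue A * stateSum A n (fun t => cr t.castSucc) c
        else stateSum A n (fun t => cr t.castSucc) (!c)) := by
  have key : stateSum A (n + 1) cr c = ∑ s : Fin n → Bool, ∑ b : Bool,
      ((A ^ (∑ t, if (Fin.snoc s b : Fin (n + 1) → Bool) t then (1 : ℤ) else -1) : Rˣ) : R) *
        loopValue A ^ (loopCount (n + 1) (fun t => (cr t).level)
          (fun t => (Fin.snoc s b : Fin (n + 1) → Bool) t = (cr t).rising) c - 1) := by
    rw [stateSum, ← (Fin.snocEquiv fun _ : Fin (n + 1) => Bool).sum_comp, Fintype.sum_prod_type,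
      Finset.sum_comm]
    rfl
  have hb : ∀ F : Bool → R, ∑ b, F b = F (!(cr (Fin.last n)).rising) + F (cr (Fin.last n)).rising :=
    fun F => by
      cases (cr (Fin.last n)).rising <;> simp [add_comm]
  have sgn : ((if (cr (Fin.last n)).rising = true then (1 : ℤ) else -1)) =
      crossSign (cr (Fin.last n)) := rfl
  have sgn' : ((if (!(cr (Fin.last n)).rising) = true then (1 : ℤ) else -1)) =
      -crossSign (cr (Fin.last n)) := by
    unfold crossSign
    cases (cr (Fin.last n)).rising <;> simp
  simp only [key, hb, Finset.sum_add_distrib, Fin.sum_univ_castSucc, Fin.snoc_castSucc,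
    Fin.snoc_last, sgn, sgn', zpow_add, Units.val_mul]
  congr 1
  · rw [stateSum, Finset.mul_sum]
    refine Finset.sum_congr rfl fun s _ => ?_
    rw [loopCount_succ_of_not_vert]
    · simp only [Fin.snoc_castSucc]
      ring
    · simp
  · split_ifs with hc
    · rw [stateSum, Finset.mul_sum, Finset.mul_sum]
      refine Finset.sum_congr rfl fun s _ => ?_
      rw [loopCount_succ_of_closed _ hc]
      · simp only [Fin.snoc_castSucc]
        have := loopCount_pos n (fun t => (cr t.castSucc).level)
          (fun t => s t = (cr t.castSucc).rising) c
        obtain ⟨l, hl⟩ := Nat.exists_eq_succ_of_ne_zero this.ne'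
        rw [hl, Nat.add_sub_cancel, Nat.succ_sub_one, pow_succ]
        ring
      · simp
    · rw [stateSum, Finset.mul_sum]
      refine Finset.sum_congr rfl fun s _ => ?_
      rw [loopCount_succ_of_open _ hc]
      · simp only [Fin.snoc_castSucc]
        ring
      · simp

/-- The bracket of the 4-plat diagram with given crossings and given closing on the right. -/
noncomputable def platBracket (w : List PlatCrossing) (c : Bool) : R :=
  (⟨w, c⟩ : PlatDiagram).kauffmanBracket A

lemma platBracket_append_singleton (w : List PlatCrossing) (t : PlatCrossing) (c : Bool) :
    platBracket A (w ++ [t]) c =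
      ((A ^ (-crossSign t) : Rˣ) : R) * platBracket A w c + ((A ^ crossSign t : Rˣ) : R) *
        (if c = decide (t.level = 1) then loopValue A * platBracket A w c
        else platBracket A w (!c)) := by
  simp only [platBracket, kauffmanBracket_eq_stateSum]
  have hlen : w.length + 1 = (w ++ [t]).length := by simp
  rw [← stateSum_cast A hlen, stateSum_succ]
  have hlast : (w ++ [t]).get (Fin.cast hlen (Fin.last w.length)) = t := by
    simp
  have hcast : (fun i : Fin w.length => (w ++ [t]).get (Fin.cast hlen i.castSucc)) = w.get := by
    funext i
    simp
  rw [hlast, hcast]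

/-- Without crossings, the left arcs and the right closing form one circle if the closing is nested
and two otherwise. -/
lemma loopCount_zero (lev : Fin 0 → Fin 3) (vert : Fin 0 → Prop) (c : Bool) :
    loopCount 0 lev vert c = if c then 1 else 2 := by
  have h01 : Quot.mk (closedArc 0 lev vert c) (0, 0) = Quot.mk _ (0, 1) :=
    Quot.sound (Or.inl (Or.inl ⟨rfl, rfl, Or.inl ⟨rfl, rfl⟩⟩))
  have h23 : Quot.mk (closedArc 0 lev vert c) (0, 2) = Quot.mk _ (0, 3) :=
    Quot.sound (Or.inl (Or.inl ⟨rfl, rfl, Or.inr ⟨rfl, rfl⟩⟩))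
  cases c
  · let f : Fin 1 × Fin 4 → Bool := fun p => ![true, true, false, false] p.2
    have e : Quot (closedArc 0 lev vert false) ≃ Bool :=
      { toFun := Quot.lift f (by
          rintro ⟨p, j⟩ ⟨q, k⟩ ((⟨-, -, h⟩ | ⟨t, -⟩) | ⟨-, -, h⟩)
          · rcases h with ⟨h, h'⟩ | ⟨h, h'⟩ <;> simp only at h h' <;> subst h h' <;> rfl
          · exact t.elim0
          · rcases (show (j = 0 ∧ k = 1) ∨ (j = 2 ∧ k = 3) from h) with ⟨rfl, rfl⟩ | ⟨rfl, rfl⟩ <;>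
              rfl)
        invFun := fun b => Quot.mk _ (0, if b then 0 else 2)
        left_inv := by
          rintro ⟨p, j⟩
          obtain rfl : p = 0 := Fin.ext (by have := p.isLt; omega)
          fin_cases j
          · rfl
          · exact h01
          · rfl
          · exact h23
        right_inv := by
          rintro (_ | _) <;> rfl }
    rw [loopCount, Nat.card_congr e]
    simp
  · have h12 : Quot.mk (closedArc 0 lev vert true) (0, 1) = Quot.mk _ (0, 2) :=
      quot_cap (n := 0) (by decide)
    have : Unique (Quot (closedArc 0 lev vert true)) :=
      { default := Quot.mk _ (0, 0)
        uniq := by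
          rintro ⟨p, j⟩
          obtain rfl : p = 0 := Fin.ext (by have := p.isLt; omega)
          fin_cases j
          · rfl
          · exact h01.symm
          · exact (h01.trans h12).symm
          · exact ((h01.trans h12).trans h23).symm }
    rw [loopCount, Nat.card_unique]
    rfl

lemma platBracket_nil (c : Bool) : platBracket A [] c = if c then 1 else loopValue A := by
  rw [platBracket, kauffmanBracket_eq_stateSum]
  change stateSum A 0 _ c = _
  rw [stateSum, Fintype.sum_unique, loopCount_zero]
  cases c <;> simp

/-- The factor of a first Reidemeister move: one smoothing of the kink is trivial, the other splits
off a loop. -/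
lemma units_kink (r : ℤ) (hr : r = 1 ∨ r = -1) :
    ((A ^ (-r) : Rˣ) : R) + ((A ^ r : Rˣ) : R) * loopValue A = ((-A ^ (3 * r) : Rˣ) : R) := by
  unfold loopValue
  rcases hr with rfl | rfl
  · have h1 : ((A ^ (1 : ℤ) : Rˣ) : R) * ((A ^ (2 : ℤ) : Rˣ) : R) = ((A ^ (3 : ℤ) : Rˣ) : R) := by
      rw [← Units.val_mul, ← zpow_add]; norm_num
    have h2 : ((A ^ (1 : ℤ) : Rˣ) : R) * ((A ^ (-2 : ℤ) : Rˣ) : R) = ((A ^ (-1 : ℤ) : Rˣ) : R) := by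
      rw [← Units.val_mul, ← zpow_add]; norm_num
    rw [Units.val_neg, mul_sub, mul_neg, h1, h2, mul_one]
    ring
  · have h1 : ((A ^ (-1 : ℤ) : Rˣ) : R) * ((A ^ (2 : ℤ) : Rˣ) : R) = ((A ^ (1 : ℤ) : Rˣ) : R) := by
      rw [← Units.val_mul, ← zpow_add]; norm_num
    have h2 : ((A ^ (-1 : ℤ) : Rˣ) : R) * ((A ^ (-2 : ℤ) : Rˣ) : R) =
        ((A ^ (-3 : ℤ) : Rˣ) : R) := by
      rw [← Units.val_mul, ← zpow_add]; norm_num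
    rw [Units.val_neg, mul_sub, mul_neg, h1, h2, neg_neg]
    norm_num
    ring

lemma crossSign_eq (t : PlatCrossing) : crossSign t = 1 ∨ crossSign t = -1 := by
  unfold crossSign
  split_ifs <;> simp

/-- A twist box whose crossings can be undone by first Reidemeister moves. -/
lemma platBracket_replicate_closed (w : List PlatCrossing) (t : PlatCrossing) (c : Bool)
    (hc : c = decide (t.level = 1)) (m : ℕ) :
    platBracket A (w ++ List.replicate m t) c =
      (((-A ^ (3 * crossSign t)) ^ m : Rˣ) : R) * platBracket A w c := by
  induction m with
  | zero => simp
  | succ m ih =>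
    rw [List.replicate_succ', ← List.append_assoc, platBracket_append_singleton, if_pos hc, ih,
      pow_succ, Units.val_mul, ← units_kink A _ (crossSign_eq t)]
    ring

/-- A twist box whose crossings twist the two closing arcs around each other. -/
lemma platBracket_replicate_open (w : List PlatCrossing) (t : PlatCrossing) (c : Bool)
    (hc : c ≠ decide (t.level = 1)) (m : ℕ) :
    platBracket A (w ++ List.replicate m t) c =
      ((A ^ (-(crossSign t * m)) : Rˣ) : R) * (platBracket A w c +
        ((A ^ (2 * crossSign t) : Rˣ) : R) * qInt m ((-A ^ (4 * crossSign t) : Rˣ) : R) *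
          platBracket A w (!c)) := by
  induction m with
  | zero => simp [qInt]
  | succ m ih =>
    have hc' : (!c) = decide (t.level = 1) := by
      cases c <;> cases h : decide (t.level = 1) <;> simp_all
    rw [List.replicate_succ', ← List.append_assoc, platBracket_append_singleton, if_neg hc, ih,
      platBracket_replicate_closed A w t _ hc']
    generalize crossSign t = r
    -- Each further crossing either keeps the closing, or switches it and turns the `m` earlier
    -- crossings into kinks. The latter contributes the next term of the geometric sum, with ratio
    -- `-A ^ (3r) / A ^ (-r) = -A ^ (4r)`.
    have e1 : (A ^ (-r) : Rˣ) * A ^ (-(r * m)) = A ^ (-(r * (m + 1 : ℕ))) := by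
      rw [← zpow_add]; congr 1; push_cast; ring
    have e2 : (A ^ r : Rˣ) * (-A ^ (3 * r)) ^ m =
        A ^ (-(r * (m + 1 : ℕ))) * A ^ (2 * r) * (-A ^ (4 * r)) ^ m := by
      rw [neg_pow, neg_pow (A ^ (4 * r))]
      rw [mul_left_comm, mul_left_comm _ ((-1 : Rˣ) ^ m)]
      congr 1
      rw [← zpow_natCast, ← zpow_natCast, ← zpow_mul, ← zpow_mul, ← zpow_add, ← zpow_add,
        ← zpow_add]
      congr 1; push_cast; ring
    have hq : qInt (m + 1) ((-A ^ (4 * r) : Rˣ) : R) =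
        qInt m ((-A ^ (4 * r) : Rˣ) : R) + ((-A ^ (4 * r) : Rˣ) : R) ^ m :=
      Finset.sum_range_succ _ _
    have e1' := congrArg (Units.val) e1
    have e2' := congrArg (Units.val) e2
    rw [Units.val_mul] at e1'
    rw [Units.val_mul, Units.val_mul, Units.val_mul, Units.val_pow_eq_pow_val (-A ^ (4 * r))] at e2'
    rw [hq, ← mul_assoc, e1', ← mul_assoc, e2']
    ring

end

/-! ### Tutte polynomials of families of connecting sets -/

section

variable {m : ℕ}

/-- The minimal members of a family of edge sets. -/
def IsTreeOf (C : Finset (Fin m) → Prop) (T : Finset (Fin m)) : Prop :=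
  C T ∧ ∀ e ∈ T, ¬ C (T.erase e)

/-- Internal activity with respect to a family of connecting sets. -/
def IntActiveOf (C : Finset (Fin m) → Prop) (T : Finset (Fin m)) (e : Fin m) : Prop :=
  ∀ f : Fin m, f ≠ e → IsTreeOf C (insert f (T.erase e)) → e < f

/-- External activity with respect to a family of connecting sets. -/
def ExtActiveOf (C : Finset (Fin m) → Prop) (T : Finset (Fin m)) (f : Fin m) : Prop :=
  ∀ e : Fin m, e ∈ insert f T ∧ C ((insert f T).erase e) → f ≤ e

open Classical in
/-- The kind of variable that the edge `e` contributes to the weight of the tree `T`. -/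
noncomputable def kindOf (C : Finset (Fin m) → Prop) (T : Finset (Fin m)) (e : Fin m) : VarKind :=
  if e ∈ T then (if IntActiveOf C T e then .bigX else .smallX)
  else (if ExtActiveOf C T e then .bigY else .smallY)

open Classical in
/-- The colored Tutte polynomial of a family of connecting sets, with values in any ring:
`w s i` is the value of the variable of kind `s` at the color of the edge `i`. -/
noncomputable def tutteOf {R : Type*} [CommRing R] (C : Finset (Fin m) → Prop)
    (w : VarKind → Fin m → R) : R :=
  ∑ T : Finset (Fin m), if IsTreeOf C T then ∏ e, w (kindOf C T e) e else 0

/-- Trees and activities see the graph only through its connecting sets. Minors can therefore be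
handled as families of sets: deletion and contraction of the last edge are composition with
`edgeLift` and `edgeLiftLast`, and no minor has to be built as a graph. -/
lemma ColoredGraph.tutte_eq_tutteOf {Λ : Type uL} {V : Type} (G : ColoredGraph Λ V m) :
    G.tutte = tutteOf G.Connects fun s e => colorVar s (G.color e) := by
  classical
  unfold ColoredGraph.tutte tutteOf
  rw [Finset.sum_filter]
  refine Finset.sum_congr rfl fun T _ => ?_
  refine if_congr Iff.rfl ?_ rfl
  rw [ColoredGraph.treeWeight, ← Finset.prod_mul_prod_compl T]
  congr 1
  · refine Finset.prod_congr rfl fun e he => ?_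
    rw [kindOf, if_pos he]
    rfl
  · refine Finset.prod_congr rfl fun e he => ?_
    rw [kindOf, if_neg (Finset.mem_compl.1 he)]
    rfl

lemma map_tutteOf {R S : Type*} [CommRing R] [CommRing S] (φ : R →+* S)
    (C : Finset (Fin m) → Prop) (w : VarKind → Fin m → R) :
    φ (tutteOf C w) = tutteOf C fun s e => φ (w s e) := by
  classical
  simp only [tutteOf, map_sum, apply_ite φ, map_prod, map_zero]

/-! ### Sets of edges in `Fin (m + 1)` -/

/-- A set of edges, with the last edge left out. -/
def edgeLift (S : Finset (Fin m)) : Finset (Fin (m + 1)) := S.map Fin.castSuccEmb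

/-- A set of edges, with the last edge added. -/
def edgeLiftLast (S : Finset (Fin m)) : Finset (Fin (m + 1)) := insert (Fin.last m) (edgeLift S)

@[simp] lemma castSucc_mem_edgeLift {S : Finset (Fin m)} {e : Fin m} : e.castSucc ∈ edgeLift S ↔ e ∈ S := by
  simp [edgeLift]

@[simp] lemma last_notMem_edgeLift {S : Finset (Fin m)} : Fin.last m ∉ edgeLift S := by
  simp [edgeLift, Fin.castSucc_ne_last]

@[simp] lemma castSucc_mem_edgeLiftLast {S : Finset (Fin m)} {e : Fin m} :
    e.castSucc ∈ edgeLiftLast S ↔ e ∈ S := by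
  simp [edgeLiftLast, Fin.castSucc_ne_last]

@[simp] lemma last_mem_edgeLiftLast {S : Finset (Fin m)} : Fin.last m ∈ edgeLiftLast S := by
  simp [edgeLiftLast]

lemma ext_castSucc {S T : Finset (Fin (m + 1))} (h : ∀ e : Fin m, e.castSucc ∈ S ↔ e.castSucc ∈ T)
    (hl : Fin.last m ∈ S ↔ Fin.last m ∈ T) : S = T := by
  ext e
  induction e using Fin.lastCases with
  | last => exact hl
  | cast e => exact h e

lemma edgeLift_erase (S : Finset (Fin m)) (e : Fin m) :
    (edgeLift S).erase e.castSucc = edgeLift (S.erase e) :=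
  ext_castSucc (by simp) (by simp)

lemma edgeLift_insert (S : Finset (Fin m)) (e : Fin m) :
    insert e.castSucc (edgeLift S) = edgeLift (insert e S) :=
  ext_castSucc (by simp) (by simp [(Fin.castSucc_ne_last _).symm])

lemma edgeLift_insert_last (S : Finset (Fin m)) : insert (Fin.last m) (edgeLift S) = edgeLiftLast S := rfl

lemma edgeLiftLast_erase (S : Finset (Fin m)) (e : Fin m) :
    (edgeLiftLast S).erase e.castSucc = edgeLiftLast (S.erase e) :=
  ext_castSucc (by simp) (by simp [(Fin.castSucc_ne_last _).symm])

lemma edgeLiftLast_insert (S : Finset (Fin m)) (e : Fin m) :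
    insert e.castSucc (edgeLiftLast S) = edgeLiftLast (insert e S) :=
  ext_castSucc (by simp) (by simp)

lemma edgeLiftLast_erase_last (S : Finset (Fin m)) : (edgeLiftLast S).erase (Fin.last m) = edgeLift S :=
  ext_castSucc (by simp [Fin.castSucc_ne_last]) (by simp)

lemma edgeLift_or_edgeLiftLast (T : Finset (Fin (m + 1))) : ∃ S, T = edgeLift S ∨ T = edgeLiftLast S := by
  refine ⟨Finset.univ.filter fun e => e.castSucc ∈ T, ?_⟩
  by_cases h : Fin.last m ∈ T
  · exact Or.inr (ext_castSucc (by simp) (by simp [h]))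
  · exact Or.inl (ext_castSucc (by simp) (by simp [h]))

lemma edgeLift_injective : Function.Injective (edgeLift (m := m)) := fun S T h => by
  ext e
  rw [← castSucc_mem_edgeLift, h, castSucc_mem_edgeLift]

lemma edgeLiftLast_injective : Function.Injective (edgeLiftLast (m := m)) := fun S T h => by
  ext e
  rw [← castSucc_mem_edgeLiftLast, h, castSucc_mem_edgeLiftLast]

lemma sum_finset_fin_succ {R : Type*} [AddCommMonoid R] (f : Finset (Fin (m + 1)) → R) :
    ∑ T, f T = ∑ S, f (edgeLift S) + ∑ S, f (edgeLiftLast S) := by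
  have hne : ∀ S T : Finset (Fin m), edgeLift S ≠ edgeLiftLast T := fun S T h =>
    last_notMem_edgeLift (h ▸ last_mem_edgeLiftLast)
  refine Eq.trans (Fintype.sum_bijective (Sum.elim edgeLift edgeLiftLast) ⟨?_, ?_⟩
    (fun x => f (Sum.elim edgeLift edgeLiftLast x)) f fun _ => rfl).symm (Fintype.sum_sum_type _)
  · rintro (S | S) (T | T) h
    · exact congrArg _ (edgeLift_injective h)
    · exact (hne _ _ h).elim
    · exact (hne _ _ h.symm).elim
    · exact congrArg _ (edgeLiftLast_injective h)
  · intro T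
    obtain ⟨S, h | h⟩ := edgeLift_or_edgeLiftLast T
    · exact ⟨Sum.inl S, h.symm⟩
    · exact ⟨Sum.inr S, h.symm⟩

/-! ### Deletion and contraction of the last edge -/

variable {C : Finset (Fin (m + 1)) → Prop} {D : Finset (Fin m) → Prop}

section Deletion

variable (hD : ∀ S, C (edgeLift S) ↔ D S)
include hD

lemma isTreeOf_edgeLift (S : Finset (Fin m)) : IsTreeOf C (edgeLift S) ↔ IsTreeOf D S := by
  unfold IsTreeOf
  rw [hD, Fin.forall_fin_succ']
  simp [edgeLift_erase, hD]

/-- The last edge has the largest label, so as a competitor it never destroys the activity of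
another edge. -/
lemma intActiveOf_edgeLift (S : Finset (Fin m)) (e : Fin m) :
    IntActiveOf C (edgeLift S) e.castSucc ↔ IntActiveOf D S e := by
  unfold IntActiveOf
  rw [Fin.forall_fin_succ']
  simp [edgeLift_erase, edgeLift_insert, isTreeOf_edgeLift hD, Fin.castSucc_lt_last]

lemma extActiveOf_edgeLift (S : Finset (Fin m)) (e : Fin m) :
    ExtActiveOf C (edgeLift S) e.castSucc ↔ ExtActiveOf D S e := by
  unfold ExtActiveOf
  rw [Fin.forall_fin_succ']
  simp [edgeLift_erase, edgeLift_insert, hD, Fin.le_last]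

lemma kindOf_edgeLift (S : Finset (Fin m)) (e : Fin m) :
    kindOf C (edgeLift S) e.castSucc = kindOf D S e := by
  classical
  simp only [kindOf, castSucc_mem_edgeLift]
  exact if_congr Iff.rfl (if_congr (intActiveOf_edgeLift hD S e) rfl rfl)
    (if_congr (extActiveOf_edgeLift hD S e) rfl rfl)

end Deletion

section Contraction

variable (hD : ∀ S, C (edgeLiftLast S) ↔ D S) (hl : ∀ S, IsTreeOf D S → ¬ C (edgeLift S))
include hD hl

/-- The family is not assumed monotone; `hl` supplies exactly the minimality at the last edge. -/
lemma isTreeOf_edgeLiftLast (S : Finset (Fin m)) : IsTreeOf C (edgeLiftLast S) ↔ IsTreeOf D S := by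
  constructor
  · rintro ⟨h1, h2⟩
    refine ⟨(hD S).1 h1, fun e he h => h2 e.castSucc (by simpa using he) ?_⟩
    rwa [edgeLiftLast_erase, hD]
  · intro h
    refine ⟨(hD S).2 h.1, ?_⟩
    rw [Fin.forall_fin_succ']
    refine ⟨fun e he => ?_, fun _ => ?_⟩
    · rw [edgeLiftLast_erase, hD]
      exact h.2 e (by simpa using he)
    · rw [edgeLiftLast_erase_last]
      exact hl S h

lemma intActiveOf_edgeLiftLast (S : Finset (Fin m)) (e : Fin m) :
    IntActiveOf C (edgeLiftLast S) e.castSucc ↔ IntActiveOf D S e := by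
  unfold IntActiveOf
  rw [Fin.forall_fin_succ']
  simp [edgeLiftLast_erase, edgeLiftLast_insert, isTreeOf_edgeLiftLast hD hl, Fin.castSucc_lt_last]

omit hl in
lemma extActiveOf_edgeLiftLast (S : Finset (Fin m)) (e : Fin m) :
    ExtActiveOf C (edgeLiftLast S) e.castSucc ↔ ExtActiveOf D S e := by
  unfold ExtActiveOf
  rw [Fin.forall_fin_succ']
  simp [edgeLiftLast_erase, edgeLiftLast_insert, hD, Fin.le_last]

lemma kindOf_edgeLiftLast (S : Finset (Fin m)) (e : Fin m) :
    kindOf C (edgeLiftLast S) e.castSucc = kindOf D S e := by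
  classical
  simp only [kindOf, castSucc_mem_edgeLiftLast]
  exact if_congr Iff.rfl (if_congr (intActiveOf_edgeLiftLast hD hl S e) rfl rfl)
    (if_congr (extActiveOf_edgeLiftLast hD S e) rfl rfl)

end Contraction

variable {R : Type*} [CommRing R] (w : VarKind → Fin (m + 1) → R)

/-- Deletion and contraction of the last edge, when it is neither a loop nor a bridge. -/
theorem tutteOf_deletion_contraction {E : Finset (Fin m) → Prop}
    (hdel : ∀ S, C (edgeLift S) ↔ D S) (hcon : ∀ S, C (edgeLiftLast S) ↔ E S)
    (hl : ∀ S, IsTreeOf E S → ¬ D S)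
    (hint : ∀ S, IsTreeOf E S → ∃ f, IsTreeOf D (insert f S))
    (hext : ∀ S, IsTreeOf D S → ∃ e ∈ S, E (S.erase e)) :
    tutteOf C w = w .smallX (Fin.last m) * tutteOf E (fun s e => w s e.castSucc) +
      w .smallY (Fin.last m) * tutteOf D (fun s e => w s e.castSucc) := by
  classical
  have hl' : ∀ S, IsTreeOf E S → ¬ C (edgeLift S) := fun S h => by rw [hdel]; exact hl S h
  unfold tutteOf
  rw [sum_finset_fin_succ, add_comm, Finset.mul_sum, Finset.mul_sum]
  congr 1 <;> refine Finset.sum_congr rfl fun S _ => ?_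
  · simp only [isTreeOf_edgeLiftLast hcon hl', mul_ite, mul_zero]
    refine ite_congr rfl (fun h => ?_) fun _ => rfl
    simp only [Fin.prod_univ_castSucc, kindOf_edgeLiftLast hcon hl']
    rw [mul_comm, kindOf, if_pos last_mem_edgeLiftLast, if_neg]
    -- The exchange edge from `hint` has a smaller label than the last edge, which is thus
    -- internally inactive.
    intro ha
    obtain ⟨f, hf⟩ := hint S h
    refine absurd (ha f.castSucc (Fin.castSucc_ne_last f) ?_) (Fin.le_last _).not_gt
    rwa [edgeLiftLast_erase_last, edgeLift_insert, isTreeOf_edgeLift hdel]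
  · simp only [isTreeOf_edgeLift hdel, mul_ite, mul_zero]
    refine ite_congr rfl (fun h => ?_) fun _ => rfl
    simp only [Fin.prod_univ_castSucc, kindOf_edgeLift hdel]
    rw [mul_comm, kindOf, if_neg last_notMem_edgeLift, if_neg]
    -- By `hext` the fundamental cycle contains an edge of smaller label, so the last edge is
    -- externally inactive.
    intro ha
    obtain ⟨e, he, hf⟩ := hext S h
    refine absurd (ha e.castSucc ⟨by simpa [Fin.castSucc_ne_last] using he, ?_⟩)
      (Fin.castSucc_lt_last e).not_ge
    rwa [edgeLift_insert_last, edgeLiftLast_erase, hcon]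

/-- Removal of the last edge, when it is a bridge. -/
theorem tutteOf_bridge (hdel : ∀ S, ¬ C (edgeLift S)) (hcon : ∀ S, C (edgeLiftLast S) ↔ D S) :
    tutteOf C w = w .bigX (Fin.last m) * tutteOf D (fun s e => w s e.castSucc) := by
  classical
  unfold tutteOf
  rw [sum_finset_fin_succ, Finset.sum_eq_zero fun S _ => if_neg fun h => hdel S h.1, zero_add,
    Finset.mul_sum]
  refine Finset.sum_congr rfl fun S _ => ?_
  simp only [isTreeOf_edgeLiftLast hcon fun S _ => hdel S, mul_ite, mul_zero]
  refine ite_congr rfl (fun h => ?_) fun _ => rfl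
  simp only [Fin.prod_univ_castSucc, kindOf_edgeLiftLast hcon fun S _ => hdel S]
  rw [mul_comm, kindOf, if_pos last_mem_edgeLiftLast, if_pos]
  -- No set avoiding a bridge connects, so there is no exchange edge and activity is vacuous.
  intro f hf hT
  obtain ⟨f, rfl⟩ := Fin.exists_castSucc_eq.2 hf
  rw [edgeLiftLast_erase_last, edgeLift_insert] at hT
  exact (hdel _ hT.1).elim

/-- Removal of the last edge, when it is a loop. -/
theorem tutteOf_loop (hdel : ∀ S, C (edgeLift S) ↔ D S) (hcon : ∀ S, C (edgeLiftLast S) ↔ D S) :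
    tutteOf C w = w .bigY (Fin.last m) * tutteOf D (fun s e => w s e.castSucc) := by
  classical
  unfold tutteOf
  have hno : ∀ S, ¬ IsTreeOf C (edgeLiftLast S) := fun S h => by
    refine h.2 _ last_mem_edgeLiftLast ?_
    rw [edgeLiftLast_erase_last, hdel, ← hcon]
    exact h.1
  rw [sum_finset_fin_succ, add_comm, Finset.sum_eq_zero fun S _ => if_neg (hno S), zero_add,
    Finset.mul_sum]
  refine Finset.sum_congr rfl fun S _ => ?_
  simp only [isTreeOf_edgeLift hdel, mul_ite, mul_zero]
  refine ite_congr rfl (fun h => ?_) fun _ => rfl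
  simp only [Fin.prod_univ_castSucc, kindOf_edgeLift hdel]
  rw [mul_comm, kindOf, if_neg last_notMem_edgeLift, if_pos]
  -- The fundamental cycle is the loop alone: any other edge on it could be erased from the tree,
  -- against minimality.
  rintro f ⟨hf, hT⟩
  rcases eq_or_ne f (Fin.last m) with rfl | hne
  · exact le_rfl
  obtain ⟨f, rfl⟩ := Fin.exists_castSucc_eq.2 hne
  rw [edgeLift_insert_last, castSucc_mem_edgeLiftLast] at hf
  rw [edgeLift_insert_last, edgeLiftLast_erase, hcon] at hT
  exact (h.2 f hf hT).elim

end

/-! ### Connecting sets of core graphs -/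

/-- Connectedness of a set of edges, in terms of functions that are constant along the edges. -/
lemma ColoredGraph.connects_iff {Λ : Type uL} {V : Type} [Nonempty V] {m : ℕ}
    (G : ColoredGraph Λ V m) (S : Finset (Fin m)) :
    G.Connects S ↔ ∀ φ : V → Prop, (∀ e ∈ S, ∀ a b, G.ends e = s(a, b) → (φ a ↔ φ b)) →
      ∀ a b, φ a ↔ φ b := by
  unfold ColoredGraph.Connects
  constructor
  · intro h φ hφ a b
    obtain ⟨p⟩ := h.preconnected a b
    induction p with
    | nil => rfl
    | cons hadj _ ih =>
      rw [SimpleGraph.fromEdgeSet_adj] at hadj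
      obtain ⟨⟨e, he, h'⟩, -⟩ := hadj
      exact (hφ e he _ _ h').trans ih
  · intro h
    refine ⟨fun a b => ?_⟩
    refine (h (fun b => SimpleGraph.Reachable _ a b) (fun e he b c hbc => ?_) a b).1
      (SimpleGraph.Reachable.refl a)
    have hr : (SimpleGraph.fromEdgeSet (G.ends '' (S : Set (Fin m)))).Reachable b c := by
      rcases eq_or_ne b c with rfl | hne
      · exact SimpleGraph.Reachable.refl b
      · exact SimpleGraph.Adj.reachable
          ((SimpleGraph.fromEdgeSet_adj _).2 ⟨⟨e, he, hbc⟩, hne⟩)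
    exact ⟨fun h' => h'.trans hr, fun h' => h'.trans hr.symm⟩

/-- The first end of the `k`-th edge of a core graph. -/
def coreSrc (k : ℕ) : ℕ := if k % 2 = 1 then 0 else k / 2

/-- The second end of the `k`-th edge of the core graph with `n` edges. -/
def coreTgt (n k : ℕ) : ℕ := if k % 2 = 1 then (k + 1) / 2 else if k < n then k / 2 + 1 else 0

/-- The sets of edges that connect the core graph with `n` edges. -/
def CoreConn (n : ℕ) (S : Finset (Fin n)) : Prop :=
  ∀ φ : ℕ → Prop, (∀ e : Fin n, e ∈ S → (φ (coreSrc (e + 1)) ↔ φ (coreTgt n (e + 1)))) →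
    ∀ i ≤ (n + 1) / 2, φ i ↔ φ 0

lemma coreGraph_ends {Λ : Type uL} (c : ℕ → Λ) (n : ℕ) (e : Fin n) :
    ∃ (h1 : coreSrc (e + 1) < (n + 1) / 2 + 1) (h2 : coreTgt n (e + 1) < (n + 1) / 2 + 1),
      (coreGraph c n).ends e = s(⟨coreSrc (e + 1), h1⟩, ⟨coreTgt n (e + 1), h2⟩) := by
  have he := e.isLt
  refine ⟨by unfold coreSrc; split_ifs <;> omega, by unfold coreTgt; split_ifs <;> omega, ?_⟩
  simp only [coreGraph, coreSrc, coreTgt]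
  split_ifs <;> rfl

/-- Test predicates on `ℕ` put all core graphs on one vertex type. A contraction then amounts to
composing a predicate with a map that collapses one vertex. -/
lemma coreGraph_connects_iff {Λ : Type uL} (c : ℕ → Λ) (n : ℕ) (S : Finset (Fin n)) :
    (coreGraph c n).Connects S ↔ CoreConn n S := by
  rw [ColoredGraph.connects_iff]
  constructor
  · intro h φ hφ i hi
    refine h (fun a => φ a) (fun e he a b hab => ?_) ⟨i, by omega⟩ 0
    obtain ⟨h1, h2, h3⟩ := coreGraph_ends c n e
    rw [h3, Sym2.eq_iff] at hab
    rcases hab with ⟨rfl, rfl⟩ | ⟨rfl, rfl⟩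
    · exact hφ e he
    · exact (hφ e he).symm
  · intro h φ hφ
    have key : ∀ i, φ i ↔ φ 0 := by
      intro i
      -- The predicate is extended by falsehood beyond the last vertex.
      have := h (fun j => ∃ hj : j < (n + 1) / 2 + 1, φ ⟨j, hj⟩) (fun e he => ?_) i (by omega)
      · have hi : (i : ℕ) ≤ (n + 1) / 2 := Nat.le_of_lt_succ i.isLt
        simpa [hi] using this
      · obtain ⟨h1, h2, h3⟩ := coreGraph_ends c n e
        simpa [h1, h2] using hφ e he _ _ h3
    exact fun a b => (key a).trans (key b).symm

section

variable {n : ℕ}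

lemma coreConn_edgeLift_iff (S : Finset (Fin n)) : CoreConn (n + 1) (edgeLift S) ↔
    ∀ φ : ℕ → Prop, (∀ e : Fin n, e ∈ S → (φ (coreSrc (e + 1)) ↔ φ (coreTgt (n + 1) (e + 1)))) →
    ∀ i ≤ (n + 1 + 1) / 2, φ i ↔ φ 0 := by
  unfold CoreConn
  simp only [Fin.forall_fin_succ', castSucc_mem_edgeLift, last_notMem_edgeLift, Fin.val_castSucc,
    false_imp_iff, and_true]

lemma coreConn_edgeLiftLast_iff (S : Finset (Fin n)) : CoreConn (n + 1) (edgeLiftLast S) ↔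
    ∀ φ : ℕ → Prop, (∀ e : Fin n, e ∈ S → (φ (coreSrc (e + 1)) ↔ φ (coreTgt (n + 1) (e + 1)))) →
    (φ (coreSrc (n + 1)) ↔ φ (coreTgt (n + 1) (n + 1))) →
    ∀ i ≤ (n + 1 + 1) / 2, φ i ↔ φ 0 := by
  unfold CoreConn
  simp only [Fin.forall_fin_succ', castSucc_mem_edgeLiftLast, last_mem_edgeLiftLast,
    Fin.val_castSucc, Fin.val_last, true_imp_iff, and_imp]

/-- Contracting the last edge merges the newest major vertex `r + 1` into the center. The preceding
edge, if any, ended at `r + 1` and now ends at `0`, as it does in the smaller core graph. -/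
lemma coreConn_odd_edgeLiftLast (hn : Even n) (S : Finset (Fin n)) :
    CoreConn (n + 1) (edgeLiftLast S) ↔ CoreConn n S := by
  rw [coreConn_edgeLiftLast_iff]
  obtain ⟨r, rfl⟩ := hn
  have h1 : coreSrc (r + r + 1) = 0 := if_pos (by omega)
  have h2 : coreTgt (r + r + 1) (r + r + 1) = r + 1 := by unfold coreTgt; split_ifs <;> omega
  rw [h1, h2]
  constructor
  · intro h φ hφ i hi
    let ρ : ℕ → ℕ := fun j => if j = r + 1 then 0 else j
    have := h (φ ∘ ρ) (fun e he => ?_) (by simp [ρ]) i (by omega)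
    · have hi' : i ≠ r + 1 := by omega
      simpa [ρ, hi'] using this
    · have h' := e.isLt
      have e1 : ρ (coreSrc (e + 1)) = coreSrc (e + 1) := by
        simp only [ρ, coreSrc]; split_ifs <;> omega
      have e2 : ρ (coreTgt (r + r + 1) (e + 1)) = coreTgt (r + r) (e + 1) := by
        simp only [ρ, coreTgt]; split_ifs <;> omega
      simpa [e1, e2] using hφ e he
  · intro h φ hφ hl i hi
    rcases (show i = r + 1 ∨ i ≤ r by omega) with rfl | hi'
    · exact hl.symm
    · refine h φ (fun e he => ?_) i (by omega)
      have h' := e.isLt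
      have h3 := hφ e he
      by_cases hk : (e : ℕ) + 1 = r + r
      · have e1 : coreTgt (r + r + 1) (e + 1) = r + 1 := by unfold coreTgt; split_ifs <;> omega
        have e2 : coreTgt (r + r) (e + 1) = 0 := by unfold coreTgt; split_ifs <;> omega
        rw [e2]
        rw [e1] at h3
        exact h3.trans hl.symm
      · have e1 : coreTgt (r + r + 1) (e + 1) = coreTgt (r + r) (e + 1) := by
          unfold coreTgt; split_ifs <;> omega
        rwa [← e1]

lemma not_coreConn_one (S : Finset (Fin 0)) : ¬ CoreConn 1 (edgeLift S) := by
  rw [coreConn_edgeLift_iff]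
  intro h
  simpa using h (fun i => i = 0) (fun e => e.elim0) 1 (by omega)

/-- Only the last two edges meet the newest major vertex; without them it is isolated. -/
lemma not_coreConn_odd (hn : Odd n) (S : Finset (Fin n)) : ¬ CoreConn (n + 2) (edgeLift (edgeLift S)) := by
  rw [coreConn_edgeLift_iff]
  obtain ⟨r, rfl⟩ := hn
  intro h
  have := h (fun i => i = r + 2) ?_ (r + 2) (by omega)
  · simp at this
  · rw [Fin.forall_fin_succ']
    refine ⟨fun e _ => ?_, by simp⟩
    have h' := e.isLt
    have h1 : coreSrc (e + 1) ≠ r + 2 := by unfold coreSrc; split_ifs <;> omega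
    have h2 : coreTgt (2 * r + 1 + 2) (e + 1) ≠ r + 2 := by unfold coreTgt; split_ifs <;> omega
    exact iff_of_false h1 h2

/-- Once the last edge is deleted, the one before it is a pendant edge, and contracting it removes
the newest vertex `r + 2`. -/
lemma coreConn_odd_edgeLift_edgeLiftLast (hn : Odd n) (S : Finset (Fin n)) :
    CoreConn (n + 2) (edgeLift (edgeLiftLast S)) ↔ CoreConn n S := by
  rw [coreConn_edgeLift_iff]
  obtain ⟨r, rfl⟩ := hn
  have h1 : coreSrc (2 * r + 1 + 1) = r + 1 := by unfold coreSrc; split_ifs <;> omega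
  have h2 : coreTgt (2 * r + 1 + 1 + 1) (2 * r + 1 + 1) = r + 2 := by
    unfold coreTgt; split_ifs <;> omega
  have h3 : ∀ e : Fin (2 * r + 1),
      coreTgt (2 * r + 1 + 1 + 1) (e + 1) = coreTgt (2 * r + 1) (e + 1) := fun e => by
    have h' := e.isLt
    unfold coreTgt; split_ifs <;> omega
  simp only [Fin.forall_fin_succ' (n := 2 * r + 1), castSucc_mem_edgeLiftLast, last_mem_edgeLiftLast,
    Fin.val_castSucc, Fin.val_last, true_imp_iff, h1, h2, h3]
  constructor
  · intro h φ hφ i hi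
    let ρ : ℕ → ℕ := fun j => if j = r + 2 then r + 1 else j
    have := h (φ ∘ ρ) ⟨fun e he => ?_, by simp [ρ]⟩ i (by omega)
    · have hi' : i ≠ r + 2 := by omega
      simpa [ρ, hi'] using this
    · have h' := e.isLt
      have e1 : ρ (coreSrc (e + 1)) = coreSrc (e + 1) := by
        simp only [ρ, coreSrc]; split_ifs <;> omega
      have e2 : ρ (coreTgt (2 * r + 1) (e + 1)) = coreTgt (2 * r + 1) (e + 1) := by
        simp only [ρ, coreTgt]; split_ifs <;> omega
      simpa [e1, e2] using hφ e he
  · rintro h φ ⟨hφ, hl⟩ i hi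
    have h4 := h φ hφ
    rcases (show i = r + 2 ∨ i ≤ r + 1 by omega) with rfl | hi'
    · exact hl.symm.trans (h4 _ (by omega))
    · exact h4 i (by omega)

/-- An even last edge adds no vertex and moves no end of another edge. -/
lemma coreConn_even_edgeLift (hn : Even n) (S : Finset (Fin (n + 1))) :
    CoreConn (n + 2) (edgeLift S) ↔ CoreConn (n + 1) S := by
  rw [coreConn_edgeLift_iff, CoreConn]
  obtain ⟨r, rfl⟩ := hn
  have h3 : ∀ e : Fin (r + r + 1),
      coreTgt (r + r + 1 + 1) (e + 1) = coreTgt (r + r + 1) (e + 1) := fun e => by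
    have h' := e.isLt
    unfold coreTgt; split_ifs <;> omega
  have h4 : (r + r + 1 + 2) / 2 = (r + r + 1 + 1) / 2 := by omega
  simp only [h3, h4]

/-- Once the last edge of a core graph with an even number of edges is contracted, the preceding
edge is a loop. -/
lemma coreConn_even_edgeLiftLast (hn : Even n) {S : Finset (Fin (n + 1))} {S' : Finset (Fin n)}
    (hS : S = edgeLift S' ∨ S = edgeLiftLast S') :
    CoreConn (n + 2) (edgeLiftLast S) ↔ CoreConn n S' := by
  have hmem : ∀ e : Fin n, e.castSucc ∈ S ↔ e ∈ S' := by
    rcases hS with rfl | rfl <;> simp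
  rw [coreConn_edgeLiftLast_iff]
  obtain ⟨r, rfl⟩ := hn
  have h1 : coreSrc (r + r + 1 + 1) = r + 1 := by unfold coreSrc; split_ifs <;> omega
  have h2 : coreTgt (r + r + 1 + 1) (r + r + 1 + 1) = 0 := by
    unfold coreTgt; split_ifs <;> omega
  have h3 : coreSrc (r + r + 1) = 0 := if_pos (by omega)
  have h4 : coreTgt (r + r + 1 + 1) (r + r + 1) = r + 1 := by unfold coreTgt; split_ifs <;> omega
  simp only [Fin.forall_fin_succ' (n := r + r), hmem, Fin.val_castSucc, Fin.val_last, h1, h2, h3, h4]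
  constructor
  · intro h φ hφ i hi
    let ρ : ℕ → ℕ := fun j => if j = r + 1 then 0 else j
    have := h (φ ∘ ρ) ⟨fun e he => ?_, by simp [ρ]⟩ (by simp [ρ]) i (by omega)
    · have hi' : i ≠ r + 1 := by omega
      simpa [ρ, hi'] using this
    · have h' := e.isLt
      have e1 : ρ (coreSrc (e + 1)) = coreSrc (e + 1) := by
        simp only [ρ, coreSrc]; split_ifs <;> omega
      have e2 : ρ (coreTgt (r + r + 1 + 1) (e + 1)) = coreTgt (r + r) (e + 1) := by
        simp only [ρ, coreTgt]; split_ifs <;> omega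
      simpa [e1, e2] using hφ e he
  · rintro h φ ⟨hφ, -⟩ hl i hi
    rcases (show i = r + 1 ∨ i ≤ r by omega) with rfl | hi'
    · exact hl
    · refine h φ (fun e he => ?_) i (by omega)
      have h' := e.isLt
      have h3 := hφ e he
      by_cases hk : (e : ℕ) + 1 = r + r
      · have e1 : coreTgt (r + r + 1 + 1) (e + 1) = r + 1 := by
          unfold coreTgt; split_ifs <;> omega
        have e2 : coreTgt (r + r) (e + 1) = 0 := by unfold coreTgt; split_ifs <;> omega
        rw [e2]
        rw [e1] at h3
        exact h3.trans hl
      · have e1 : coreTgt (r + r + 1 + 1) (e + 1) = coreTgt (r + r) (e + 1) := by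
          unfold coreTgt; split_ifs <;> omega
        rwa [← e1]

/-! ### Spanning trees of core graphs -/

lemma isTreeOf_even_edgeLiftLast (hn : Even n) {S : Finset (Fin (n + 1))}
    (h : IsTreeOf (fun S => CoreConn (n + 2) (edgeLiftLast S)) S) :
    ∃ S', S = edgeLift S' ∧ IsTreeOf (CoreConn n) S' := by
  obtain ⟨S', rfl | rfl⟩ := edgeLift_or_edgeLiftLast S
  · exact ⟨S', rfl, (isTreeOf_edgeLift (fun T => coreConn_even_edgeLiftLast hn (Or.inl rfl)) S').1 h⟩
  · refine (h.2 _ last_mem_edgeLiftLast ?_).elim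
    change CoreConn (n + 2) (edgeLiftLast _)
    rw [edgeLiftLast_erase_last, coreConn_even_edgeLiftLast hn (Or.inl rfl),
      ← coreConn_even_edgeLiftLast hn (Or.inr rfl)]
    exact h.1

lemma isTreeOf_of_edgeLiftLast {m : ℕ} {C : Finset (Fin (m + 1)) → Prop} {S : Finset (Fin m)}
    (h : IsTreeOf C (edgeLiftLast S)) : IsTreeOf (fun S => C (edgeLiftLast S)) S :=
  ⟨h.1, fun e he => by
    change ¬ C (edgeLiftLast _)
    rw [← edgeLiftLast_erase]
    exact h.2 _ (castSucc_mem_edgeLiftLast.2 he)⟩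

/-- The next core graph has one more vertex, so a tree has one edge too few. Concretely, either the
new vertex is isolated, or the last edge of the tree has become pendant and the remaining edges
would already connect, against minimality. -/
lemma not_coreConn_edgeLift_of_isTreeOf (hn : Even n) {S : Finset (Fin n)}
    (h : IsTreeOf (CoreConn n) S) : ¬ CoreConn (n + 1) (edgeLift S) := by
  match n, hn, S, h with
  | 0, _, S, _ => exact not_coreConn_one S
  | 1, hn, _, _ => exact absurd hn (by decide)
  | n + 2, hn, S, h =>
    have hn' : Even n := by simpa [Nat.even_add] using hn
    obtain ⟨S', rfl | rfl⟩ := edgeLift_or_edgeLiftLast S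
    · exact not_coreConn_odd (n := n + 1) hn'.add_one S'
    · rw [coreConn_odd_edgeLift_edgeLiftLast (n := n + 1) hn'.add_one, ← coreConn_even_edgeLift hn',
        ← edgeLiftLast_erase_last]
      exact h.2 _ last_mem_edgeLiftLast

lemma isTreeOf_odd_edgeLiftLast (hn : Even n) {S : Finset (Fin n)} (h : IsTreeOf (CoreConn n) S) :
    IsTreeOf (CoreConn (n + 1)) (edgeLiftLast S) :=
  (isTreeOf_edgeLiftLast (coreConn_odd_edgeLiftLast hn)
    (fun _ h => not_coreConn_edgeLift_of_isTreeOf hn h) S).2 h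

/-! ### The recursion for the Tutte polynomials of core graphs -/

variable {R : Type*} [CommRing R] (w : VarKind → ℕ → R)

/-- The Tutte polynomial of the core graph with `n` edges, in a ring where the variable of kind `s`
at the color of the `k`-th edge has the value `w s k`. -/
noncomputable def coreTutte (n : ℕ) : R := tutteOf (CoreConn n) fun s e => w s (e + 1)

lemma coreTutte_zero : coreTutte w 0 = 1 := by
  classical
  unfold coreTutte tutteOf
  rw [Fintype.sum_unique, if_pos]
  · simp
  · exact ⟨fun φ _ i hi => by simp_all, fun e => e.elim0⟩

lemma coreTutte_one : coreTutte w 1 = w .bigX 1 := by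
  have h := tutteOf_bridge (C := CoreConn 1) (D := CoreConn 0) (fun s e => w s (e + 1))
    not_coreConn_one (coreConn_odd_edgeLiftLast (n := 0) (by decide))
  have h0 := coreTutte_zero w
  unfold coreTutte at h0 ⊢
  rw [h]
  simp only [Fin.val_castSucc, h0]
  simp

/-- Deletion of the last edge leaves the previous core graph; its contraction turns edge `n + 1`
into a loop, which gives the factor `Y`. -/
lemma coreTutte_even (hn : Even n) : coreTutte w (n + 2) =
    w .smallY (n + 2) * coreTutte w (n + 1) +
      w .bigY (n + 1) * w .smallX (n + 2) * coreTutte w n := by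
  have hl : ∀ S, IsTreeOf (fun S => CoreConn (n + 2) (edgeLiftLast S)) S → ¬ CoreConn (n + 1) S := by
    intro S h
    obtain ⟨S', rfl, h'⟩ := isTreeOf_even_edgeLiftLast hn h
    exact not_coreConn_edgeLift_of_isTreeOf hn h'
  have hint : ∀ S, IsTreeOf (fun S => CoreConn (n + 2) (edgeLiftLast S)) S →
      ∃ f, IsTreeOf (CoreConn (n + 1)) (insert f S) := by
    intro S h
    obtain ⟨S', rfl, h'⟩ := isTreeOf_even_edgeLiftLast hn h
    exact ⟨Fin.last n, isTreeOf_odd_edgeLiftLast hn h'⟩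
  have hext : ∀ S, IsTreeOf (CoreConn (n + 1)) S →
      ∃ e ∈ S, CoreConn (n + 2) (edgeLiftLast (S.erase e)) := by
    intro S h
    obtain ⟨S', rfl | rfl⟩ := edgeLift_or_edgeLiftLast S
    · match n, hn, S', h with
      | 0, _, S', h => exact (not_coreConn_one S' h.1).elim
      | 1, hn, _, _ => exact absurd hn (by decide)
      | n + 2, hn, S', h =>
        have hn' : Even n := by simpa [Nat.even_add] using hn
        obtain ⟨S'', rfl | rfl⟩ := edgeLift_or_edgeLiftLast S'
        · exact (not_coreConn_odd (n := n + 1) hn'.add_one S'' h.1).elim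
        -- The odd edge is absent from the tree, so the newest major vertex hangs on the preceding
        -- even edge alone. This edge therefore lies on the cycle closed by the last edge.
        · refine ⟨(Fin.last _).castSucc, by simp, ?_⟩
          rw [edgeLift_erase, edgeLiftLast_erase_last, coreConn_even_edgeLiftLast hn (Or.inl rfl),
            coreConn_even_edgeLift hn', ← coreConn_odd_edgeLift_edgeLiftLast (n := n + 1) hn'.add_one]
          exact h.1
    · refine ⟨Fin.last n, last_mem_edgeLiftLast, ?_⟩
      rw [edgeLiftLast_erase_last, coreConn_even_edgeLiftLast hn (Or.inl rfl), ← coreConn_odd_edgeLiftLast hn]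
      exact h.1
  have h1 := tutteOf_deletion_contraction (C := CoreConn (n + 2)) (fun s e => w s (e + 1))
    (coreConn_even_edgeLift hn) (fun _ => Iff.rfl) hl hint hext
  have h2 := tutteOf_loop (C := fun S : Finset (Fin (n + 1)) => CoreConn (n + 2) (edgeLiftLast S))
    (D := CoreConn n) (fun s e => w s (e + 1))
    (fun S => coreConn_even_edgeLiftLast hn (Or.inl rfl))
    (fun S => coreConn_even_edgeLiftLast hn (Or.inr rfl))
  simp only [Fin.val_castSucc, Fin.val_last] at h1 h2
  unfold coreTutte
  rw [h1, h2]
  ring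

/-- Dually, contraction of the last edge leaves the previous core graph; its deletion turns edge `n
+ 2` into a bridge, which gives the factor `X`. -/
lemma coreTutte_odd (hn : Even n) : coreTutte w (n + 3) =
    w .smallX (n + 3) * coreTutte w (n + 2) +
      w .bigX (n + 2) * w .smallY (n + 3) * coreTutte w (n + 1) := by
  have hn1 : Odd (n + 1) := hn.add_one
  have hn2 : Even (n + 2) := hn.add (by decide)
  have hbr : ∀ S, IsTreeOf (fun S => CoreConn (n + 3) (edgeLift S)) (edgeLiftLast S) ↔
      IsTreeOf (CoreConn (n + 1)) S :=
    isTreeOf_edgeLiftLast (C := fun S : Finset (Fin (n + 2)) => CoreConn (n + 3) (edgeLift S))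
      (coreConn_odd_edgeLift_edgeLiftLast hn1) fun S _ => not_coreConn_odd hn1 S
  have hl : ∀ S, IsTreeOf (CoreConn (n + 2)) S → ¬ CoreConn (n + 3) (edgeLift S) := fun S h =>
    not_coreConn_edgeLift_of_isTreeOf hn2 h
  have hint : ∀ S, IsTreeOf (CoreConn (n + 2)) S →
      ∃ f, IsTreeOf (fun S => CoreConn (n + 3) (edgeLift S)) (insert f S) := by
    intro S h
    obtain ⟨S', rfl | rfl⟩ := edgeLift_or_edgeLiftLast S
    · exact ⟨Fin.last _, (hbr S').2 ((isTreeOf_edgeLift (coreConn_even_edgeLift hn) S').1 h)⟩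
    · obtain ⟨S'', rfl, h'⟩ := isTreeOf_even_edgeLiftLast hn (isTreeOf_of_edgeLiftLast h)
      -- A tree containing edge `n + 2` omits edge `n + 1`, a loop after contraction of the former;
      -- edge `n + 1` is the exchange edge.
      refine ⟨(Fin.last n).castSucc, ?_⟩
      rw [edgeLiftLast_insert, edgeLift_insert_last, hbr]
      exact isTreeOf_odd_edgeLiftLast hn h'
  have hext : ∀ S, IsTreeOf (fun S => CoreConn (n + 3) (edgeLift S)) S →
      ∃ e ∈ S, CoreConn (n + 2) (S.erase e) := by
    intro S h
    obtain ⟨S', rfl | rfl⟩ := edgeLift_or_edgeLiftLast S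
    · exact (not_coreConn_odd hn1 S' h.1).elim
    · refine ⟨Fin.last _, last_mem_edgeLiftLast, ?_⟩
      rw [edgeLiftLast_erase_last, coreConn_even_edgeLift hn, ← coreConn_odd_edgeLift_edgeLiftLast hn1]
      exact h.1
  have h1 := tutteOf_deletion_contraction (C := CoreConn (n + 3)) (fun s e => w s (e + 1))
    (fun _ => Iff.rfl) (coreConn_odd_edgeLiftLast hn2) hl hint hext
  have h2 := tutteOf_bridge (C := fun S : Finset (Fin (n + 2)) => CoreConn (n + 3) (edgeLift S))
    (D := CoreConn (n + 1)) (fun s e => w s (e + 1))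
    (not_coreConn_odd hn1) (coreConn_odd_edgeLift_edgeLiftLast hn1)
  simp only [Fin.val_castSucc, Fin.val_last] at h1 h2
  unfold coreTutte
  rw [h1, h2]
  ring

lemma coreGraph_tutte_eq {Λ : Type uL} (c : ℕ → Λ) (n : ℕ) :
    (coreGraph c n).tutte = coreTutte (fun s k => colorVar s (c k)) n := by
  rw [ColoredGraph.tutte_eq_tutteOf, coreTutte]
  have : (coreGraph c n).Connects = CoreConn n :=
    funext fun S => propext (coreGraph_connects_iff c n S)
  rw [this]
  rfl

lemma map_coreTutte {S : Type*} [CommRing S] (φ : R →+* S) (n : ℕ) :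
    φ (coreTutte w n) = coreTutte (fun s k => φ (w s k)) n :=
  map_tutteOf φ _ _

end

/-! ### Continuants -/

/-- The sequence `S_{-1}, S_0, S_1, …` with `S_{-1} = u`, `S_0 = 1` and
`S_n = c_n S_{n - 1} + S_{n - 2}`, with its indices shifted by one. -/
def continuant {R : Type*} [CommRing R] (c : ℕ → R) (u : R) : ℕ → R
  | 0 => u
  | 1 => 1
  | n + 2 => c (n + 1) * continuant c u (n + 1) + continuant c u n

lemma continuant_add_two {R : Type*} [CommRing R] (c : ℕ → R) (u : R) (n : ℕ) :
    continuant c u (n + 2) = c (n + 1) * continuant c u (n + 1) + continuant c u n := rfl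

lemma descProd_mulVec {R : Type*} [CommRing R] (c : ℕ → R) (u : R) (n : ℕ) :
    (descProd (fun k => !![c k, 1; 1, 0]) n).mulVec ![1, u] =
      ![continuant c u (n + 1), continuant c u n] := by
  induction n with
  | zero => simp [descProd, continuant]
  | succ n ih =>
    rw [descProd, ← Matrix.mulVec_mulVec, ih]
    ext i
    fin_cases i <;> simp [Matrix.mulVec, dotProduct, continuant]

/-- Dividing the recursion by `S_n` gives one layer of the fraction. Since `S_0 = 1`, the innermost
layer is `c_1 + u`, with no inversion of `u`. -/
lemma continuant_div {K : Type*} [Field K] (c : ℕ → K) (u : K) (n : ℕ)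
    (h : ∀ k ≤ n, continuant c u (k + 1) ≠ 0) :
    continuant c u (n + 2) / continuant c u (n + 1) = contFrac c u (n + 1) := by
  induction n with
  | zero => simp [continuant, contFrac]
  | succ n ih =>
    rw [contFrac, ← ih fun k hk => h k (by omega), one_div_div, continuant, add_div,
      mul_div_cancel_right₀ _ (h (n + 1) le_rfl)]

lemma semifactorial_add_two {R : Type*} [CommRing R] (p : ℕ → R) (n : ℕ) :
    semifactorial p (n + 2) = semifactorial p n * p (n + 2) := by
  unfold semifactorial
  rw [show (n + 2) / 2 + 1 = n / 2 + 1 + 1 by omega, Finset.prod_range_succ, Nat.add_mod_right]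
  congr 2
  omega

/-! ### Core graphs -/

section

variable {K : Type*} [Field K] {X x Y y : ℕ → K}

lemma coreU_ne_zero (hX : ∀ k, X k ≠ 0) (hx : ∀ k, x k ≠ 0) (hY : ∀ k, Y k ≠ 0)
    (hy : ∀ k, y k ≠ 0) : ∀ k, coreU X x Y y k ≠ 0
  | 0 => one_ne_zero
  | 1 => hy 1
  | k + 2 => by
    rw [coreU]
    split_ifs
    · exact mul_ne_zero (hX _) (hy _)
    · exact mul_ne_zero (hY _) (hx _)

lemma semifactorial_ne_zero {p : ℕ → K} (h : ∀ k, p k ≠ 0) (n : ℕ) : semifactorial p n ≠ 0 :=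
  Finset.prod_ne_zero_iff.2 fun _ _ => h _

lemma coreTutte_add_two (w : VarKind → ℕ → K) (n : ℕ) : coreTutte w (n + 2) =
    coreV (w .smallX) (w .smallY) (n + 2) * coreTutte w (n + 1) +
      coreU (w .bigX) (w .smallX) (w .bigY) (w .smallY) (n + 2) * coreTutte w n := by
  rw [coreV, coreU]
  rcases Nat.even_or_odd n with hn | hn
  · rw [if_neg (by simpa [Nat.odd_add] using hn), if_neg (by simpa using hn), coreTutte_even w hn]
  · rw [if_pos (hn.add_even (by decide)), if_pos hn]
    obtain ⟨r, rfl⟩ := hn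
    exact coreTutte_odd w (even_two_mul r)

/-- The semifactorial gains the factor `u_{n+2}` in two steps, which cancels the second coefficient
of the recursion. The case `n = 1` is where the value of `u` enters. -/
lemma coreTutte_eq_semifactorial_mul (w : VarKind → ℕ → K) (hw : ∀ s k, w s k ≠ 0) (u : K)
    (hu : (w .bigX 1 - w .smallX 1) / w .smallY 1 = u) (n : ℕ) :
    coreTutte w n = semifactorial (coreU (w .bigX) (w .smallX) (w .bigY) (w .smallY)) n *
      continuant (coreC (w .bigX) (w .smallX) (w .bigY) (w .smallY)) u (n + 1) := by
  have hsf := semifactorial_ne_zero (coreU_ne_zero (hw .bigX) (hw .smallX) (hw .bigY) (hw .smallY))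
  induction n using Nat.twoStepInduction with
  | zero => simp [coreTutte_zero, semifactorial, coreU, continuant]
  | one =>
    have h1 := hw .smallY 1
    subst hu
    simp [coreTutte_one, semifactorial, coreU, continuant, coreC, coreV]
    field_simp
    ring
  | more n ih1 ih2 =>
    rw [coreTutte_add_two, ih1, ih2, continuant_add_two _ _ (n + 1)]
    have h1 := hsf (n + 2)
    rw [coreC, show n + 1 + 1 - 1 = n + 1 from rfl]
    rw [mul_add (semifactorial _ (n + 2)), ← mul_assoc (semifactorial _ (n + 2)),
      mul_div_cancel₀ _ h1]
    rw [semifactorial_add_two]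
    ring

end

/-- Modulo `I₁`, the quotient `(X_l - x_l) / y_l` does not depend on `l`. -/
lemma color_quotient_eq {Λ : Type uL} {K : Type uK} [Field K] (φ : ColorRing Λ →+* K)
    (hφ : ∀ f ∈ idealI1 Λ, φ f = 0) (hy : ∀ l, φ (colorVar .smallY l) ≠ 0) (l m : Λ) :
    (φ (colorVar .bigX l) - φ (colorVar .smallX l)) / φ (colorVar .smallY l) =
      (φ (colorVar .bigX m) - φ (colorVar .smallX m)) / φ (colorVar .smallY m) := by
  have h := hφ _ (Ideal.subset_span (Or.inl ⟨l, m, rfl⟩))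
  simp only [Matrix.det_fin_two_of, map_sub, map_mul] at h
  rw [div_eq_div_iff (hy l) (hy m)]
  linear_combination h

theorem coreGraph_continuant (Λ : Type uL) (P : Ideal (ColorRing Λ)) [P.IsPrime]
    (hP : idealI1 Λ ≤ P) (hvar : ∀ (s : VarKind) (l : Λ), colorVar s l ∉ P)
    (K : Type uK) [Field K] [Algebra (ColorRing Λ ⧸ P) K] [IsFractionRing (ColorRing Λ ⧸ P) K]
    (c : ℕ → Λ) :
    let toK : ColorRing Λ → K := fun f => algebraMap (ColorRing Λ ⧸ P) K (Ideal.Quotient.mk P f)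
    let X : ℕ → K := fun k => toK (colorVar .bigX (c k))
    let x : ℕ → K := fun k => toK (colorVar .smallX (c k))
    let Y : ℕ → K := fun k => toK (colorVar .bigY (c k))
    let y : ℕ → K := fun k => toK (colorVar .smallY (c k))
    let T : ℕ → K := fun n => toK (coreGraph c n).tutte
    ∃ u : K,
      (∀ l : Λ, (toK (colorVar .bigX l) - toK (colorVar .smallX l)) / toK (colorVar .smallY l)
        = u) ∧
      ∃ S : ℤ → K, S (-1) = u ∧
        ∀ n : ℕ,
          semifactorial (coreU X x Y y) n ≠ 0 ∧
          T n = semifactorial (coreU X x Y y) n * S n ∧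
          ![S n, S (n - 1)] =
            (descProd (fun k => !![coreC X x Y y k, 1; 1, 0]) n).mulVec ![1, u] ∧
          (1 ≤ n → (∀ k : ℕ, k < n → S k ≠ 0) →
            S n / S (n - 1) = contFrac (coreC X x Y y) u n) := by
  intro toK X x Y y T
  let φ : ColorRing Λ →+* K := (algebraMap (ColorRing Λ ⧸ P) K).comp (Ideal.Quotient.mk P)
  have hφ : ∀ f, φ f = 0 ↔ f ∈ P := fun f => by
    rw [← Ideal.Quotient.eq_zero_iff_mem]
    exact map_eq_zero_iff _ (IsFractionRing.injective (ColorRing Λ ⧸ P) K)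
  have hne : ∀ s l, φ (colorVar s l) ≠ 0 := fun s l h => hvar s l ((hφ _).1 h)
  let w : VarKind → ℕ → K := fun s k => φ (colorVar s (c k))
  have hT : ∀ n, T n = coreTutte w n := fun n => by
    change φ _ = _
    rw [coreGraph_tutte_eq, map_coreTutte]
  have hw : ∀ s k, w s k ≠ 0 := fun s k => hne s (c k)
  let u : K := (w .bigX 1 - w .smallX 1) / w .smallY 1
  have hS : ∀ n : ℕ, ((n : ℤ) + 1).toNat = n + 1 := fun n => by omega
  have hS' : ∀ n : ℕ, ((n : ℤ) - 1 + 1).toNat = n := fun n => by omega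
  -- The index shift places `S (-1)` at position `0` of `continuant`.
  refine ⟨u, fun l => color_quotient_eq φ (fun f hf => (hφ f).2 (hP hf)) (hne .smallY) l (c 1),
    fun z => continuant (coreC X x Y y) u (z + 1).toNat, rfl, fun n => ⟨?_, ?_, ?_, ?_⟩⟩
  · exact semifactorial_ne_zero
      (coreU_ne_zero (hw .bigX) (hw .smallX) (hw .bigY) (hw .smallY)) n
  · simp only [hS, hT]
    exact coreTutte_eq_semifactorial_mul w hw u rfl n
  · simp only [hS, hS', descProd_mulVec]
  · intro hn h
    obtain ⟨n, rfl⟩ := Nat.exists_eq_add_of_le' hn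
    simp only [hS, hS'] at h ⊢
    exact continuant_div _ u n fun k hk => h k (by omega)

/-! ### Rational links -/

section

variable {R : Type uR} [CommRing R] (A : Rˣ) (a : ℕ → ℤ)

lemma crossSign_boxCrossing (i : ℕ) {z : ℤ} (hz : z ≠ 0) :
    crossSign (boxCrossing i z) = (-1) ^ (i + 1) * z.sign := by
  unfold crossSign boxCrossing
  rcases neg_one_pow_eq_or ℤ (i + 1) with h | h <;> rcases lt_or_gt_of_ne hz with h' | h' <;>
    simp [h, Int.sign_eq_neg_one_of_neg, Int.sign_eq_one_of_pos, h']

lemma boxCrossing_level (i : ℕ) (z : ℤ) :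
    decide ((boxCrossing i z).level = 1) = decide (Odd i) := by
  unfold boxCrossing
  by_cases h : Odd i <;> simp [h]

lemma rationalDiagram_word_succ (n : ℕ) : (rationalDiagram a (n + 1)).word =
    (rationalDiagram a n).word ++
      List.replicate (a (n + 1)).natAbs (boxCrossing (n + 1) (a (n + 1))) := by
  simp [rationalDiagram, List.range_succ]

lemma kauffmanBracket_rationalDiagram (n : ℕ) : (rationalDiagram a n).kauffmanBracket A =
    platBracket A (rationalDiagram a n).word (decide (Even n)) := rfl

/-- Since `ε |a| = a` and `-1` is its own inverse, a sign in the base can be moved to the exponent.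
-/
lemma units_neg_zpow_sign (k : ℤ) {z : ℤ} (hz : z ≠ 0) :
    (-A ^ (k * z.sign)) ^ z.natAbs = (-A ^ k) ^ z := by
  rcases lt_or_gt_of_ne hz with h | h
  · rw [Int.sign_eq_neg_one_of_neg h, mul_neg_one, zpow_neg, ← inv_neg, inv_pow, ← zpow_natCast,
      ← zpow_neg]
    congr 1
    omega
  · rw [Int.sign_eq_one_of_pos h, mul_one, ← zpow_natCast]
    congr 1
    omega

/-- By parity, no arc of the standard closing joins the two strands of the last box. -/
lemma platBracket_rationalDiagram_open (n : ℕ) (h : a (n + 1) ≠ 0) :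
    (rationalDiagram a (n + 1)).kauffmanBracket A =
      ((A ^ (-((-1) ^ (n + 2) * a (n + 1))) : Rˣ) : R) *
        (platBracket A (rationalDiagram a n).word (decide (Even (n + 1))) +
          ((A ^ (2 * (-1) ^ (n + 2) * (a (n + 1)).sign) : Rˣ) : R) *
            qInt (a (n + 1)).natAbs ((-(A ^ (4 * (-1) ^ (n + 2) * (a (n + 1)).sign)) : Rˣ) : R) *
            (rationalDiagram a n).kauffmanBracket A) := by
  have hc : (!decide (Even (n + 1))) = decide (Even n) := by
    by_cases hn : Even n <;> simp [hn, Nat.even_add_one]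
  rw [kauffmanBracket_rationalDiagram, kauffmanBracket_rationalDiagram, rationalDiagram_word_succ,
    platBracket_replicate_open, crossSign_boxCrossing _ h, hc]
  · rw [mul_assoc, mul_assoc 2, mul_assoc 4, Int.sign_mul_natAbs]
  · rw [boxCrossing_level]
    by_cases hn : Even n <;> simp [hn, Nat.even_add_one, Nat.odd_add_one]

/-- The closing suited to the next box joins the strands of this box, whose crossings are then
kinks. -/
lemma platBracket_rationalDiagram_closed (n : ℕ) (h : a (n + 1) ≠ 0) :
    platBracket A (rationalDiagram a (n + 1)).word (decide (Even (n + 2))) =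
      (((-A ^ (3 * (-1) ^ (n + 2) : ℤ)) ^ a (n + 1) : Rˣ) : R) *
        (rationalDiagram a n).kauffmanBracket A := by
  have hc : decide (Even (n + 2)) = decide (Even n) := by
    simp [Nat.even_add]
  rw [kauffmanBracket_rationalDiagram, rationalDiagram_word_succ, hc,
    platBracket_replicate_closed, crossSign_boxCrossing _ h, ← mul_assoc,
    units_neg_zpow_sign A _ h]
  rw [boxCrossing_level]
  by_cases hn : Even n <;> simp [hn, Nat.odd_add_one]

/-! ### Exponents of the normalizing factors -/

/-- `ω_k` as a unit, in terms of `A^{(-1)^k}` and of the two sums of the `a_i`. -/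
lemma omegaCoeff_eq (k : ℕ) : omegaCoeff A a k =
    (((-(A ^ ((-1) ^ k : ℤ)) ^ (2 : ℤ)) ^ (∑ i ∈ Finset.Ico 1 k with Odd (k + i), a i) *
      (A ^ ((-1) ^ k : ℤ)) ^ (∑ i ∈ Finset.Icc 1 k, a i) : Rˣ) : R) := by
  rw [omegaCoeff, ← zpow_mul, ← zpow_mul, mul_comm 2]

lemma sum_Ico_odd_add_two (k : ℕ) : ∑ i ∈ Finset.Ico 1 (k + 2) with Odd (k + 2 + i), a i =
    ∑ i ∈ Finset.Ico 1 k with Odd (k + i), a i + a (k + 1) := by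
  have h : ∀ i, Odd (k + 2 + i) ↔ Odd (k + i) := fun i => by
    rw [add_right_comm, Nat.odd_add]; simp
  simp only [Finset.sum_filter, h]
  rw [Finset.sum_Ico_succ_top (by omega), if_pos ⟨k, by ring⟩]
  congr 1
  rcases Nat.eq_zero_or_pos k with rfl | hk
  · simp
  · rw [Finset.sum_Ico_succ_top (by omega), if_neg (by simp), add_zero]

/-- The two alternating sums split the indices `1, …, k` by parity. This determines the sign
relating consecutive `ω`. -/
lemma sum_Ico_odd_add (k : ℕ) : ∑ i ∈ Finset.Ico 1 (k + 1) with Odd (k + 1 + i), a i +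
    ∑ i ∈ Finset.Ico 1 k with Odd (k + i), a i = ∑ i ∈ Finset.Icc 1 k, a i := by
  induction k with
  | zero => simp
  | succ k ih =>
    rw [sum_Ico_odd_add_two, Finset.sum_Icc_succ_top (by omega), ← ih]
    ring

lemma units_neg_zpow (g : Rˣ) (z : ℤ) : (-g) ^ z = (-1) ^ z * g ^ z := by
  rw [← mul_zpow, neg_one_mul]

/-- The identity behind `ω_{n+2} = β ω_n`, where `β` is the coefficient of the bracket two steps
back. -/
lemma units_omega_closed (B : Rˣ) (o s p q : ℤ) :
    B ^ q * (-B ^ (3 : ℤ)) ^ p * ((-B ^ (2 : ℤ)) ^ o * B ^ s) =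
      (-B ^ (2 : ℤ)) ^ (o + p) * B ^ (s + p + q) := by
  have hB : B ^ q * (B ^ (3 : ℤ)) ^ p * ((B ^ (2 : ℤ)) ^ o * B ^ s) =
      (B ^ (2 : ℤ)) ^ (o + p) * B ^ (s + p + q) := by
    simp only [← zpow_mul, ← zpow_add]
    congr 1
    ring
  rw [units_neg_zpow, units_neg_zpow (B ^ (2 : ℤ)) o, units_neg_zpow (B ^ (2 : ℤ)),
    mul_assoc ((-1) ^ (o + p)), ← hB, zpow_add]
  simp only [mul_comm, mul_left_comm, mul_assoc]

/-- The ratio of consecutive `ω`, which yields the last factor of `γ`. The inverse of `B` appears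
because `(-1)^k` changes sign from one index to the next. -/
lemma units_omega_open (B : Rˣ) (o o' s q : ℤ) (h : o + o' = s) :
    B ^ q * ((-(B⁻¹) ^ (2 : ℤ)) ^ o' * (B⁻¹) ^ s) =
      (-B ^ (2 : ℤ)) ^ o * B ^ (s + q) * (-B ^ (-4 : ℤ)) ^ s := by
  obtain rfl : o = s - o' := by omega
  have hsign : ((-1 : Rˣ)) ^ (s - o') * (-1) ^ s = (-1) ^ o' := by
    rw [← zpow_add, show s - o' + s = 2 * (s - o') + o' by ring, zpow_add, zpow_mul]
    norm_num
  have hB : B ^ q * (((B⁻¹) ^ (2 : ℤ)) ^ o' * (B⁻¹) ^ s) =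
      (B ^ (2 : ℤ)) ^ (s - o') * B ^ (s + q) * (B ^ (-4 : ℤ)) ^ s := by
    simp only [inv_zpow', ← zpow_mul, ← zpow_add]
    congr 1
    ring
  calc _ = (-1) ^ o' * (B ^ q * (((B⁻¹) ^ (2 : ℤ)) ^ o' * (B⁻¹) ^ s)) := by
        rw [units_neg_zpow, mul_assoc ((-1) ^ o'), mul_left_comm]
    _ = _ := by
        rw [hB, ← hsign, units_neg_zpow (B ^ (2 : ℤ)), units_neg_zpow (B ^ (-4 : ℤ)),
          mul_mul_mul_comm, mul_assoc ((-1) ^ (s - o')) ((B ^ (2 : ℤ)) ^ (s - o'))]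

theorem kauffmanBracket_eq_omegaCoeff_mul {N : ℕ} (ha : ∀ i, 1 ≤ i → i ≤ N → a i ≠ 0) (n : ℕ)
    (hn : n ≤ N) : (rationalDiagram a n).kauffmanBracket A = omegaCoeff A a n *
      continuant (gammaCoeff A a) (PlatDiagram.loopValue A) (n + 1) := by
  induction n using Nat.twoStepInduction with
  | zero =>
    rw [kauffmanBracket_rationalDiagram]
    change platBracket A [] _ = _
    rw [platBracket_nil]
    simp [omegaCoeff, continuant]
  | one =>
    rw [platBracket_rationalDiagram_open A a 0 (ha 1 le_rfl hn), kauffmanBracket_rationalDiagram]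
    change _ * (platBracket A [] _ + _ * platBracket A [] _) = _
    rw [platBracket_nil, platBracket_nil]
    simp [omegaCoeff, continuant, gammaCoeff]
    ring
  | more n ih1 ih2 =>
    have h1 := ha (n + 1) (by omega) (by omega)
    have h2 := ha (n + 2) (by omega) hn
    rw [platBracket_rationalDiagram_open A a (n + 1) h2,
      platBracket_rationalDiagram_closed A a n h1, ih1 (by omega), ih2 (by omega)]
    -- With `B = A ^ ((-1) ^ n)` the parity sign disappears from the exponents to be compared: `ω_n`
    -- and `ω_{n+2}` are expressed in `B`, and `ω_{n+1}` in its inverse.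
    set B : Rˣ := A ^ ((-1) ^ n : ℤ) with hB
    have p1 : ((-1 : ℤ)) ^ (n + 1) = -(-1) ^ n := by ring
    have p2 : ((-1 : ℤ)) ^ (n + 2) = (-1) ^ n := by ring
    have p3 : ((-1 : ℤ)) ^ (n + 3) = -(-1) ^ n := by ring
    have e1 : A ^ (-((-1) ^ (n + 1 + 2) * a (n + 1 + 1))) = B ^ a (n + 2) := by
      rw [hB, ← zpow_mul]; congr 1; rw [p3]; ring
    have e2 : A ^ (3 * (-1) ^ (n + 2) : ℤ) = B ^ (3 : ℤ) := by
      rw [hB, ← zpow_mul, p2, mul_comm]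
    have e3 : A ^ (4 * (-1) ^ (n + 3) : ℤ) = B ^ (-4 : ℤ) := by
      rw [hB, ← zpow_mul, p3]; congr 1; ring
    have e4 : A ^ ((-1) ^ (n + 1) : ℤ) = B⁻¹ := by
      rw [hB, ← zpow_neg, p1]
    have s1 : ∑ i ∈ Finset.Icc 1 (n + 2), a i = ∑ i ∈ Finset.Icc 1 (n + 1), a i + a (n + 2) :=
      Finset.sum_Icc_succ_top (by omega) _
    have s0 : ∑ i ∈ Finset.Icc 1 (n + 1), a i = ∑ i ∈ Finset.Icc 1 n, a i + a (n + 1) :=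
      Finset.sum_Icc_succ_top (by omega) _
    have w0 : omegaCoeff A a n = _ := omegaCoeff_eq A a n
    have w1 : omegaCoeff A a (n + 1) = _ := omegaCoeff_eq A a (n + 1)
    have w2 : omegaCoeff A a (n + 2) = _ := omegaCoeff_eq A a (n + 2)
    rw [p2] at w2
    rw [e4] at w1
    rw [← hB] at w0 w2
    have u1 : ((B ^ a (n + 2) : Rˣ) : R) * (((-B ^ (3 : ℤ)) ^ a (n + 1) : Rˣ) : R) *
        omegaCoeff A a n = omegaCoeff A a (n + 2) := by
      rw [w0, w2, ← Units.val_mul, ← Units.val_mul, units_omega_closed, sum_Ico_odd_add_two, s1, s0]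
    have u2 : ((B ^ a (n + 2) : Rˣ) : R) * omegaCoeff A a (n + 1) = omegaCoeff A a (n + 2) *
        (((-B ^ (-4 : ℤ)) ^ (∑ i ∈ Finset.Ico 1 (n + 2), a i) : Rˣ) : R) := by
      rw [w1, w2, ← Units.val_mul, ← Units.val_mul,
        units_omega_open B _ _ _ _ (sum_Ico_odd_add a (n + 1)), s1]
      rfl
    rw [continuant_add_two _ _ (n + 1), gammaCoeff, e1, e2]
    change _ = _ * (_ * (((-A ^ (4 * (-1) ^ (n + 3) : ℤ)) ^ _ : Rˣ) : R) * _ + _)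
    rw [e3]
    generalize continuant (gammaCoeff A a) (PlatDiagram.loopValue A) (n + 1) = κ0
    generalize continuant (gammaCoeff A a) (PlatDiagram.loopValue A) (n + 1 + 1) = κ1
    -- `u1` makes the coefficient of `κ_n` equal to 1, and `u2` turns that of `κ_{n+1}` into
    -- `γ_{n+2}`.
    linear_combination κ0 * u1 + ((A ^ (2 * (-1) ^ (n + 3) * (a (n + 2)).sign) : Rˣ) : R) *
      qInt (a (n + 2)).natAbs ((-(A ^ (4 * (-1) ^ (n + 3) * (a (n + 2)).sign)) : Rˣ) : R) * κ1 * u2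

end

theorem corollary5p4 :
    -- core graphs, over the fraction field of `ℤ[Λ] / P`
    (∀ (Λ : Type uL) (P : Ideal (ColorRing Λ)) [P.IsPrime] (_ : idealI1 Λ ≤ P)
      (_ : ∀ (s : VarKind) (l : Λ), colorVar s l ∉ P)
      (K : Type uK) [Field K] [Algebra (ColorRing Λ ⧸ P) K] [IsFractionRing (ColorRing Λ ⧸ P) K]
      (c : ℕ → Λ),
      let toK : ColorRing Λ → K := fun f => algebraMap (ColorRing Λ ⧸ P) K (Ideal.Quotient.mk P f)
      let X : ℕ → K := fun k => toK (colorVar .bigX (c k))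
      let x : ℕ → K := fun k => toK (colorVar .smallX (c k))
      let Y : ℕ → K := fun k => toK (colorVar .bigY (c k))
      let y : ℕ → K := fun k => toK (colorVar .smallY (c k))
      let T : ℕ → K := fun n => toK (coreGraph c n).tutte
      ∃ u : K,
        (∀ l : Λ, (toK (colorVar .bigX l) - toK (colorVar .smallX l)) / toK (colorVar .smallY l)
          = u) ∧
        ∃ S : ℤ → K, S (-1) = u ∧
          ∀ n : ℕ,
            semifactorial (coreU X x Y y) n ≠ 0 ∧
            T n = semifactorial (coreU X x Y y) n * S n ∧
            ![S n, S (n - 1)] =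
              (descProd (fun k => !![coreC X x Y y k, 1; 1, 0]) n).mulVec ![1, u] ∧
            (1 ≤ n → (∀ k : ℕ, k < n → S k ≠ 0) →
              S n / S (n - 1) = contFrac (coreC X x Y y) u n)) ∧
    -- the Kauffman bracket of the rational link diagrams
    (∀ (R : Type uR) [CommRing R] (A : Rˣ) (N : ℕ) (a : ℕ → ℤ)
      (_ : ∀ i, 1 ≤ i → i ≤ N → a i ≠ 0),
      ∃ κ : ℤ → R, κ (-1) = PlatDiagram.loopValue A ∧
        ∀ n : ℕ, n ≤ N →
          (rationalDiagram a n).kauffmanBracket A = omegaCoeff A a n * κ n ∧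
          ![κ n, κ (n - 1)] =
            (descProd (fun k => !![gammaCoeff A a k, 1; 1, 0]) n).mulVec
              ![1, PlatDiagram.loopValue A]) := by
  refine ⟨fun Λ P _ hP hvar K _ _ _ c => coreGraph_continuant Λ P hP hvar K c,
    fun R _ A N a ha => ⟨fun z => continuant (gammaCoeff A a) (PlatDiagram.loopValue A)
      (z + 1).toNat, rfl, fun n hn => ⟨?_, ?_⟩⟩⟩
  · have hS : ((n : ℤ) + 1).toNat = n + 1 := by omega
    simp only [hS]
    exact kauffmanBracket_eq_omegaCoeff_mul A a ha n hn
  · have hS : ((n : ℤ) + 1).toNat = n + 1 := by omega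
    have hS' : ((n : ℤ) - 1 + 1).toNat = n := by omega
    simp only [hS, hS', descProd_mulVec]
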